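/- Let $\mathcal H_1,\dots,\mathcal H_q$ be finitely many pairwise distinct hyperplanes of $\mathbb R^d$, any two of them parallel or orthogonal, and let $\Gamma=\bigcup_j\mathcal H_j$. Let $(\mathcal M_k)$ be the finite partition of $\mathbb R^d$ into the nonempty sets of points that have the same position (on it, or on the same open side) with respect to every $\mathcal H_j$. Those $\mathcal M_k$ that do not meet $\Gamma$ are the open cells $\Omega_i$ (the connected components of $\mathbb R^d\setminus\Gamma$); the others partition $\Gamma$. Let $T>0$, let $\mathcal A\subset\mathbb R^N$ be compact, let $f:\mathbb R^d\times\mathcal A\to\mathbb R^d$, $\ell:\mathbb R^d\times\mathcal A\to\mathbb R$, and put $F(x)=f(x,\mathcal A)$, $L(x)=\ell(x,\mathcal A)$. Assume, "locally Lipschitz" for set-valued maps being meant with respect to the Hausdorff distance: * **(HF)** $F$ has nonempty compact images and is upper semicontinuous; $F|_{\overline{\Omega}_i}$ is locally Lipschitz for each $i$; $|v|\le c_f(1+|x|)$ for all $v\in F(x)$, for some $c_f>0$. * **(HL)** $L$ has nonempty compact images and is upper semicontinuous; $L|_{\overline{\Omega}_i}$ is locally Lipschitz for each $i$; $0\le c\le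 c_l(1+|x|^{\lambda_l})$ for all $c\in L(x)$, for some $c_l>0$, $\lambda_l\ge1$. * **(HG)** the augmented dynamics $G(x)=\{(f(x,a),-\ell(x,a)-r): a\in\mathcal A,\ 0\le r\le c_l(1+|x|^{\lambda_l})-\ell(x,a)\}$ has convex images; moreover $G|_{\overline\Omega_i}$ is locally Lipschitz for each $i$. * **(H2)** there is $r_1>0$ with $B(0,r_1)\subset F(x)$ for all $x\in\Gamma$. For a closed set $C$ and $x\in C$ let $\mathcal T_C(x)=\{v:\liminf_{s\to0^+} d(x+sv,C)/s=0\}$. For $x\in\overline{\mathcal M_k}$ let $F_k^{\rm ext}(x)$ be the value at $x$ of the extension by continuity of $F|_{\mathcal M_k}$ to $\overline{\mathcal M_k}$, that is, the set of $v$ with $d(v,F(y))\to0$ as $y\to x$, $y\in\mathcal M_k$. Put $$A^E_{\mathcal M_k}(x)=\{a\in\mathcal A: f(x,a)\in F_k^{\rm ext}(x)\cap\mathcal T_{\overline{\mathcal M_k}}(x)\},\qquad A^E(x)=\bigcup_{k:\,x\in\overline{\mathcal M_k}}A^E_{\mathcal M_k}(x),$$ $$H^E(x,p)=\sup_{a\in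 A^E(x)}\{-p\cdot f(x,a)-\ell(x,a)\}\qquad(\sup\emptyset=-\infty).$$ A function $u:[0,T]\times\mathbb R^d\to\mathbb R$ is a viscosity solution of $$-\partial_tu+H^E(x,Du)=0\ \text{ in }(0,T)\times\mathbb R^d,\qquad u(T,\cdot)=\psi,\qquad\qquad(\ast)$$ if $u(T,\cdot)=\psi$ and the following two conditions hold. * Supersolution: $u$ is lower semicontinuous on $(0,T]\times\mathbb R^d$, and $-\phi_t(t_0,x_0)+H^E(x_0,D\phi(t_0,x_0))\ge0$ whenever $\phi\in C^1((0,T)\times\mathbb R^d)$ and $u-\phi$ has a local minimum at $(t_0,x_0)\in(0,T)\times\mathbb R^d$. * Subsolution: $u$ is upper semicontinuous on $(0,T]\times\mathbb R^d$, and for every $(t_0,x_0)\in(0,T)\times\mathbb R^d$, every $k$ with $x_0\in\overline{\mathcal M_k}$ and every continuous $\phi:(0,T)\times\mathbb R^d\to\mathbb R$ that is $C^1$ on $(0,T)\times\overline{\mathcal M_k}$ (its differential along $(0,T)\times\mathcal M_k$ exists and extends continuously to $(0,T)\times\overline{\mathcal M_k}$), if $u-\phi$ has a local maximum relative to $(0,T)\times\overline{\mathcal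 M_k}$ at $(t_0,x_0)$, then $$-p_t+\sup_{a\in A^E_{\mathcal M_k}(x_0)}\{-p_x\cdot f(x_0,a)-\ell(x_0,a)\}\le0,$$ where $(p_t,p_x)$ is the extended differential of $\phi$ at $(t_0,x_0)$. Let $f^n:\mathbb R^d\times\mathcal A\to\mathbb R^d$ and $\ell^n:\mathbb R^d\times\mathcal A\to\mathbb R$ satisfy (HF) and (HL) with constants (growth constants, exponent and local Lipschitz constants) independent of $n$, and let $f^n\to f$ and $\ell^n\to\ell$ locally uniformly on $\mathbb R^d\times\mathcal A$. Let $\varphi$ and $\varphi_n$ ($n\in\mathbb N$) be Lipschitz continuous functions on $\mathbb R^d$ with $\varphi_n\to\varphi$ locally uniformly. For each $n$, let $u_n$ be a viscosity solution of $(\ast)$ for the data $(f^n,\ell^n)$ with $\psi=\varphi_n$, such that the restriction of $u_n$ to $[0,T]\times\Gamma$ is locally Lipschitz continuous. **Theorem.** If $u_n\to u$ locally uniformly on $[0,T]\times\mathbb R^d$ and $u$ is continuous, then $u$ is a viscosity solution of $(\ast)$ for the data $(f,\ell)$ with $\psi=\varphi$. -/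

import Mathlib

open Filter Topology Set
open scoped NNReal ENNReal

noncomputable section

namespace HJB

/-- The state space `ℝ^d` with its Euclidean norm. -/
abbrev Pt (d : ℕ) := EuclideanSpace ℝ (Fin d)

/-- Finitely many pairwise distinct hyperplanes `{x | ⟨n_j, x⟩ = c_j}` of `ℝ^d`, any two of which are
parallel or orthogonal. As is always possible, parallel hyperplanes carry the same unit normal. -/
structure MultiDomain (d : ℕ) where
  q : ℕ
  normal : Fin q → Pt d
  offset : Fin q → ℝ
  norm_normal : ∀ j, ‖normal j‖ = 1
  parallel_or_perp : ∀ i j, normal i = normal j ∨ inner ℝ (normal i) (normal j) = 0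
  distinct : ∀ i j, normal i = normal j → offset i = offset j → i = j

namespace MultiDomain

variable {d : ℕ} (D : MultiDomain d)

/-- The hyperplane `ℋ_j`. -/
def hyperplane (j : Fin D.q) : Set (Pt d) := {x | inner ℝ (D.normal j) x = D.offset j}

/-- The interface `Γ = ⋃_j ℋ_j`. -/
def interface : Set (Pt d) := ⋃ j, D.hyperplane j

/-- The subdomains `ℳ_k` of the partition of `ℝ^d` induced by the hyperplanes: points that lie in the
same position (negative side, on it, positive side) with respect to each hyperplane. The index `k`
is the sign vector `σ`; only the nonempty sets matter. -/
def stratum (σ : Fin D.q → SignType) : Set (Pt d) :=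
  {x | ∀ j, SignType.sign (inner ℝ (D.normal j) x - D.offset j) = σ j}

/-- The sign vectors of the cells `Ω_i`, which lie on no hyperplane. All the other strata make up a
partition of `Γ` into the pieces `Γ_k`. -/
def IsCell (σ : Fin D.q → SignType) : Prop := ∀ j, σ j ≠ 0

theorem cell_disjoint_interface (σ : Fin D.q → SignType) (hσ : D.IsCell σ) :
    D.interface ∩ D.stratum σ = ∅ := by
  ext x
  simp only [interface, mem_inter_iff, mem_iUnion, mem_empty_iff_false, iff_false, not_and]
  rintro ⟨j, hj⟩ hx
  apply hσ j
  rw [← hx j, sign_eq_zero_iff, sub_eq_zero]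
  exact hj

theorem interface_union_cells :
    D.interface ∪ ⋃ σ ∈ {σ | D.IsCell σ}, D.stratum σ = univ := by
  ext x
  simp only [mem_univ, iff_true, mem_union, mem_iUnion, exists_prop, mem_ofPred_eq]
  by_cases h : x ∈ D.interface
  · exact Or.inl h
  · refine Or.inr ⟨fun j => SignType.sign (inner ℝ (D.normal j) x - D.offset j), ?_, fun j => rfl⟩
    intro j hj
    rw [sign_eq_zero_iff, sub_eq_zero] at hj
    exact h (mem_iUnion.2 ⟨j, hj⟩)

theorem isOpen_cell (σ : Fin D.q → SignType) (hσ : D.IsCell σ) : IsOpen (D.stratum σ) := by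
  have : D.stratum σ =
      ⋂ j, {x | SignType.sign (inner ℝ (D.normal j) x - D.offset j) = σ j} := by
    ext x; simp [stratum]
  rw [this]
  refine isOpen_iInter_of_finite fun j => ?_
  have h0 := hσ j
  rcases hs : σ j with _ | _ | _
  · exact absurd hs h0
  · have : {x : Pt d | SignType.sign (inner ℝ (D.normal j) x - D.offset j) = SignType.neg} =
        {x | inner ℝ (D.normal j) x < D.offset j} := by
      ext x; exact sign_eq_neg_one_iff.trans sub_neg
    rw [this]
    exact isOpen_lt (by fun_prop) (by fun_prop)
  · have : {x : Pt d | SignType.sign (inner ℝ (D.normal j) x - D.offset j) = SignType.pos} =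
        {x | D.offset j < inner ℝ (D.normal j) x} := by
      ext x; exact sign_eq_one_iff.trans sub_pos
    rw [this]
    exact isOpen_lt (by fun_prop) (by fun_prop)

theorem convex_stratum (σ : Fin D.q → SignType) : Convex ℝ (D.stratum σ) := by
  intro x hx y hy a b ha hb hab j
  have e : inner ℝ (D.normal j) (a • x + b • y) - D.offset j =
      a * (inner ℝ (D.normal j) x - D.offset j) + b * (inner ℝ (D.normal j) y - D.offset j) := by
    rw [inner_add_right, inner_smul_right, inner_smul_right]
    linear_combination D.offset j * hab
  have h1 := hx j
  have h2 := hy j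
  rw [e]
  generalize inner ℝ (D.normal j) x - D.offset j = s at *
  generalize inner ℝ (D.normal j) y - D.offset j = t at *
  rcases hs : σ j with _ | _ | _
  · rw [hs] at h1 h2
    have h1' : s = 0 := sign_eq_zero_iff.1 h1
    have h2' : t = 0 := sign_eq_zero_iff.1 h2
    rw [h1', h2']
    simp
  · rw [hs] at h1 h2
    have h1' : s < 0 := sign_eq_neg_one_iff.1 h1
    have h2' : t < 0 := sign_eq_neg_one_iff.1 h2
    refine sign_eq_neg_one_iff.2 ?_
    rcases ha.eq_or_lt with h | h
    · have : b = 1 := by linarith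
      subst h this; simpa using h2'
    · nlinarith
  · rw [hs] at h1 h2
    have h1' : 0 < s := sign_eq_one_iff.1 h1
    have h2' : 0 < t := sign_eq_one_iff.1 h2
    refine sign_eq_one_iff.2 ?_
    rcases ha.eq_or_lt with h | h
    · have : b = 1 := by linarith
      subst h this; simpa using h2'
    · nlinarith

end MultiDomain

/-- The (contingent) tangent cone `{v | liminf_{s → 0+} d_C(x + s v) / s = 0}`. -/
def tangentCone {d : ℕ} (C : Set (Pt d)) (x : Pt d) : Set (Pt d) :=
  {v | liminf (fun s : ℝ => Metric.infDist (x + s • v) C / s) (𝓝[>] 0) = 0}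

section Dynamics

variable {d N : ℕ}

/-- `F(x) = {f(x,a) : a ∈ 𝒜}`. -/
def dyn (𝒜 : Set (Pt N)) (f : Pt d → Pt N → Pt d) (x : Pt d) : Set (Pt d) := f x '' 𝒜

/-- `L(x) = {ℓ(x,a) : a ∈ 𝒜}`. -/
def costSet (𝒜 : Set (Pt N)) (ℓ : Pt d → Pt N → ℝ) (x : Pt d) : Set ℝ := ℓ x '' 𝒜

/-- The augmented dynamics
`G(x) = {(f(x,a), -ℓ(x,a) - r) : a ∈ 𝒜, 0 ≤ r ≤ c_l (1 + |x|^λ) - ℓ(x,a)}`. -/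
def augDyn (𝒜 : Set (Pt N)) (f : Pt d → Pt N → Pt d) (ℓ : Pt d → Pt N → ℝ) (cl lam : ℝ)
    (x : Pt d) : Set (Pt d × ℝ) :=
  {z | ∃ a ∈ 𝒜, ∃ r : ℝ, 0 ≤ r ∧ r ≤ cl * (1 + ‖x‖ ^ lam) - ℓ x a ∧ z = (f x a, -ℓ x a - r)}

/-- A set-valued map is locally Lipschitz on `S` for the Hausdorff distance: for each `R` it is
Lipschitz with constant `K R` on the part of `S` in the ball of radius `R`. -/
def LipschitzOnBalls {Y : Type*} [PseudoEMetricSpace Y] (K : ℝ → ℝ≥0) (S : Set (Pt d))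
    (Φ : Pt d → Set Y) : Prop :=
  ∀ R : ℝ, ∀ x ∈ S ∩ Metric.closedBall 0 R, ∀ y ∈ S ∩ Metric.closedBall 0 R,
    Metric.hausdorffEDist (Φ x) (Φ y) ≤ K R * edist x y

/-- Assumption (HF), with growth constant `cf` and local Lipschitz constants `K`. -/
structure HF (D : MultiDomain d) (𝒜 : Set (Pt N)) (f : Pt d → Pt N → Pt d)
    (cf : ℝ) (K : ℝ → ℝ≥0) : Prop where
  nonempty : ∀ x, (dyn 𝒜 f x).Nonempty
  compact : ∀ x, IsCompact (dyn 𝒜 f x)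
  usc : UpperHemicontinuous (dyn 𝒜 f)
  lipschitz : ∀ σ, D.IsCell σ → LipschitzOnBalls K (closure (D.stratum σ)) (dyn 𝒜 f)
  cf_pos : 0 < cf
  growth : ∀ x, ∀ v ∈ dyn 𝒜 f x, ‖v‖ ≤ cf * (1 + ‖x‖)

/-- Assumption (HL), with growth constants `cl`, `lam` and local Lipschitz constants `K`. -/
structure HL (D : MultiDomain d) (𝒜 : Set (Pt N)) (ℓ : Pt d → Pt N → ℝ)
    (cl lam : ℝ) (K : ℝ → ℝ≥0) : Prop where
  nonempty : ∀ x, (costSet 𝒜 ℓ x).Nonempty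
  compact : ∀ x, IsCompact (costSet 𝒜 ℓ x)
  usc : UpperHemicontinuous (costSet 𝒜 ℓ)
  lipschitz : ∀ σ, D.IsCell σ → LipschitzOnBalls K (closure (D.stratum σ)) (costSet 𝒜 ℓ)
  cl_pos : 0 < cl
  one_le_lam : 1 ≤ lam
  growth : ∀ x, ∀ c ∈ costSet 𝒜 ℓ x, 0 ≤ c ∧ c ≤ cl * (1 + ‖x‖ ^ lam)

/-- Assumption (HG): `G` has convex images. -/
def HG (𝒜 : Set (Pt N)) (f : Pt d → Pt N → Pt d) (ℓ : Pt d → Pt N → ℝ) (cl lam : ℝ) : Prop :=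
  ∀ x, Convex ℝ (augDyn 𝒜 f ℓ cl lam x)

/-- The augmented dynamics `G` is locally Lipschitz on the closure of each cell `Ω_i`. -/
def AugLipschitz (D : MultiDomain d) (𝒜 : Set (Pt N)) (f : Pt d → Pt N → Pt d)
    (ℓ : Pt d → Pt N → ℝ) (cl lam : ℝ) : Prop :=
  ∃ K : ℝ → ℝ≥0, ∀ σ, D.IsCell σ →
    LipschitzOnBalls K (closure (D.stratum σ)) (augDyn 𝒜 f ℓ cl lam)

/-- Assumption (H2): controllability on the interface. -/
def H2 (D : MultiDomain d) (𝒜 : Set (Pt N)) (f : Pt d → Pt N → Pt d) : Prop :=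
  ∃ r₁ : ℝ, 0 < r₁ ∧ ∀ x ∈ D.interface, Metric.ball 0 r₁ ⊆ dyn 𝒜 f x

/-- The extension by continuity `F_k^ext(x)`, `x ∈ closure M`, of `F` restricted to `M`: the set of
points whose distance to `F(y)` tends to `0` as `y → x` in `M`. -/
def dynExt (𝒜 : Set (Pt N)) (f : Pt d → Pt N → Pt d) (M : Set (Pt d)) (x : Pt d) : Set (Pt d) :=
  {v | Tendsto (fun y => Metric.infDist v (dyn 𝒜 f y)) (𝓝[M] x) (𝓝 0)}

/-- `F^E_M(x) = F_M^ext(x) ∩ T_{closure M}(x)`, for `x ∈ closure M`. -/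
def essDyn (𝒜 : Set (Pt N)) (f : Pt d → Pt N → Pt d) (M : Set (Pt d)) (x : Pt d) : Set (Pt d) :=
  dynExt 𝒜 f M x ∩ tangentCone (closure M) x

/-- `A^E_M(x) = {a ∈ 𝒜 : f(x,a) ∈ F^E_M(x)}`, for `x ∈ closure M`. -/
def essCtrlOn (𝒜 : Set (Pt N)) (f : Pt d → Pt N → Pt d) (M : Set (Pt d)) (x : Pt d) :
    Set (Pt N) :=
  {a | a ∈ 𝒜 ∧ f x a ∈ essDyn 𝒜 f M x}

/-- `A^E(x)`, the union of the `A^E_{ℳ_k}(x)` over the strata with `x ∈ closure ℳ_k`. -/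
def essCtrl (D : MultiDomain d) (𝒜 : Set (Pt N)) (f : Pt d → Pt N → Pt d) (x : Pt d) :
    Set (Pt N) :=
  {a | ∃ σ, x ∈ closure (D.stratum σ) ∧ a ∈ essCtrlOn 𝒜 f (D.stratum σ) x}

/-- `sup_{a ∈ S} {-p · f(x,a) - ℓ(x,a)}`, in the extended reals (`-∞` if `S` is empty), with the
vector `p` given as the linear form `v ↦ p · v`. -/
def hamSup (f : Pt d → Pt N → Pt d) (ℓ : Pt d → Pt N → ℝ) (S : Set (Pt N))
    (x : Pt d) (p : Pt d →L[ℝ] ℝ) : EReal :=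
  ⨆ a ∈ S, ((-p (f x a) - ℓ x a : ℝ) : EReal)

/-- The essential Hamiltonian `H^E`. -/
def hamE (D : MultiDomain d) (𝒜 : Set (Pt N)) (f : Pt d → Pt N → Pt d) (ℓ : Pt d → Pt N → ℝ)
    (x : Pt d) (p : Pt d →L[ℝ] ℝ) : EReal :=
  hamSup f ℓ (essCtrl D 𝒜 f x) x p

/-- Time component of a differential on `ℝ × ℝ^d`. -/
def timePart (δ : ℝ × Pt d →L[ℝ] ℝ) : ℝ := δ (1, 0)

/-- Space component of a differential on `ℝ × ℝ^d`. -/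
def spacePart (δ : ℝ × Pt d →L[ℝ] ℝ) : Pt d →L[ℝ] ℝ :=
  δ.comp (ContinuousLinearMap.inr ℝ ℝ (Pt d))

/-- Viscosity supersolution of `-∂_t u + H^E(x, Du) = 0`. -/
def IsSupersolution (D : MultiDomain d) (𝒜 : Set (Pt N)) (f : Pt d → Pt N → Pt d)
    (ℓ : Pt d → Pt N → ℝ) (T : ℝ) (u : ℝ × Pt d → ℝ) : Prop :=
  LowerSemicontinuousOn u (Ioc 0 T ×ˢ univ) ∧
  ∀ (t : ℝ) (x : Pt d), t ∈ Ioo 0 T →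
    ∀ φ : ℝ × Pt d → ℝ, ContDiffOn ℝ 1 φ (Ioo 0 T ×ˢ univ) →
      IsLocalMin (fun z => u z - φ z) (t, x) →
      0 ≤ ((-timePart (fderiv ℝ φ (t, x)) : ℝ) : EReal) +
        hamE D 𝒜 f ℓ x (spacePart (fderiv ℝ φ (t, x)))

/-- `φ` is `C¹` on `(0,T) × closure M` and `δ` is its extended differential: `δ z` is the differential
of `φ` along `(0,T) × M` at the points `z` of this set, and `δ` is continuous up to
`(0,T) × closure M`. For a relatively open convex `M`, only the values of `δ` in the directions of
the affine hull of `M` are determined by `φ`, and only those are used below. -/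
def HasExtDiff (T : ℝ) (M : Set (Pt d)) (φ : ℝ × Pt d → ℝ)
    (δ : ℝ × Pt d → (ℝ × Pt d →L[ℝ] ℝ)) : Prop :=
  ContinuousOn δ (Ioo 0 T ×ˢ closure M) ∧
  ∀ z ∈ Ioo 0 T ×ˢ M, HasFDerivWithinAt φ (δ z) (Ioo 0 T ×ˢ M) z

/-- Viscosity subsolution of `-∂_t u + H^E(x, Du) = 0`: on the closure of each stratum `ℳ_k`, the test
functions are continuous, and `C¹` on `(0,T) × closure ℳ_k`. -/
def IsSubsolution (D : MultiDomain d) (𝒜 : Set (Pt N)) (f : Pt d → Pt N → Pt d)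
    (ℓ : Pt d → Pt N → ℝ) (T : ℝ) (u : ℝ × Pt d → ℝ) : Prop :=
  UpperSemicontinuousOn u (Ioc 0 T ×ˢ univ) ∧
  ∀ (t : ℝ) (x : Pt d), t ∈ Ioo 0 T → ∀ σ, x ∈ closure (D.stratum σ) →
    ∀ (φ : ℝ × Pt d → ℝ) (δ : ℝ × Pt d → (ℝ × Pt d →L[ℝ] ℝ)),
      ContinuousOn φ (Ioo 0 T ×ˢ univ) → HasExtDiff T (D.stratum σ) φ δ →
      IsLocalMaxOn (fun z => u z - φ z) (Ioo 0 T ×ˢ closure (D.stratum σ)) (t, x) →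
      ((-timePart (δ (t, x)) : ℝ) : EReal) +
        hamSup f ℓ (essCtrlOn 𝒜 f (D.stratum σ) x) x (spacePart (δ (t, x))) ≤ 0

/-- Viscosity solution of `-∂_t u + H^E(x, Du) = 0` with final condition `u(T, ·) = ψ`. -/
def IsSolution (D : MultiDomain d) (𝒜 : Set (Pt N)) (f : Pt d → Pt N → Pt d)
    (ℓ : Pt d → Pt N → ℝ) (T : ℝ) (ψ : Pt d → ℝ) (u : ℝ × Pt d → ℝ) : Prop :=
  IsSupersolution D 𝒜 f ℓ T u ∧ IsSubsolution D 𝒜 f ℓ T u ∧ ∀ x, u (T, x) = ψ x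

end Dynamics

end HJB

end

open HJB

/-!
A set-valued map that is Hausdorff continuous on each of the finitely many closed cells is Hausdorff
continuous on `ℝ^d`, the closed cells being a closed cover. So are `F` and `G`, and since every
direction is tangent to some closed cell, `A^E(x) = 𝒜`: the supersolution property is stable by the
usual perturbation of a strict local minimum.

For the subsolution property on a stratum `M` of lower dimension, the difficulty is that no
controllability or convexity is assumed of `fⁿ`, so an essential control of `f` on `M` need not be
approximated by controls of `fⁿ` whose velocities are exactly tangent to `M`. One therefore tests
`uₙ` on an adjacent closed cell rather than on `M`, with the function
`φ ∘ P + |z - z₀|² + n * (sum of the squared distances to the hyperplanes containing M)`,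
`P` being the orthogonal projection to the affine hull of `M`. The maximum points converge to `z₀`.
By (H2) and the convexity of `G`, the velocity of the given control can be perturbed so as to point
strictly into the cell, or strictly back to the affine hull, with respect to each hyperplane through
`z₀`. Such strict inequalities survive in `fⁿ`; they give an essential control for the closed cell
along which the unbounded derivative of the penalty is nonpositive, hence can be discarded.
-/

namespace HJB

theorem sign_eq_of_cast_mul_nonneg {s : SignType} {r : ℝ} (hs : s ≠ 0) (hr : r ≠ 0)
    (h : 0 ≤ (s : ℝ) * r) : SignType.sign r = s := by
  rcases s with _ | _ | _
  · exact absurd rfl hs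
  · exact sign_eq_neg_one_iff.2 (lt_of_le_of_ne (by simpa using h) hr)
  · exact sign_eq_one_iff.2 (lt_of_le_of_ne (by simpa using h) hr.symm)

theorem sign_coe (s : SignType) : SignType.sign (s : ℝ) = s := by
  rcases s with _ | _ | _ <;> simp

theorem tendsto_add_smul_nhdsGT_zero {E : Type*} [AddCommGroup E] [Module ℝ E]
    [TopologicalSpace E] [ContinuousAdd E] [ContinuousSMul ℝ E] (x v : E) :
    Tendsto (fun s : ℝ => x + s • v) (𝓝[>] 0) (𝓝 x) := by
  have hc : Continuous fun s : ℝ => x + s • v := by fun_prop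
  simpa using (hc.tendsto 0).mono_left nhdsWithin_le_nhds

theorem tendsto_lineMap_nhdsGT_zero {E : Type*} [AddCommGroup E] [Module ℝ E]
    [TopologicalSpace E] [IsTopologicalAddGroup E] [ContinuousSMul ℝ E] (x y : E) :
    Tendsto (AffineMap.lineMap x y) (𝓝[>] (0 : ℝ)) (𝓝 x) := by
  have hc : Continuous (AffineMap.lineMap x y : ℝ → E) := AffineMap.lineMap_continuous
  simpa using (hc.tendsto 0).mono_left nhdsWithin_le_nhds

section TangentCone

variable {d : ℕ} {C : Set (Pt d)} {x v : Pt d}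

theorem eventually_infDist_add_smul_div_le (hx : x ∈ C) :
    ∀ᶠ s : ℝ in 𝓝[>] 0, Metric.infDist (x + s • v) C / s ≤ ‖v‖ := by
  filter_upwards [self_mem_nhdsWithin] with s (hs : 0 < s)
  rw [div_le_iff₀ hs, mul_comm]
  simpa only [dist_self_add_left, norm_smul, Real.norm_of_nonneg hs.le] using
    Metric.infDist_le_dist_of_mem (x := x + s • v) hx

theorem mem_tangentCone_of_frequently_mem (h : ∃ᶠ s : ℝ in 𝓝[>] 0, x + s • v ∈ C) :
    v ∈ tangentCone C x := by
  have hnonneg : ∀ᶠ s : ℝ in 𝓝[>] 0, 0 ≤ Metric.infDist (x + s • v) C / s := by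
    filter_upwards [self_mem_nhdsWithin] with s (hs : 0 < s)
    exact div_nonneg Metric.infDist_nonneg hs.le
  have hzero : ∃ᶠ s : ℝ in 𝓝[>] 0, Metric.infDist (x + s • v) C / s ≤ 0 :=
    h.mono fun s hs => by rw [Metric.infDist_zero_of_mem hs, zero_div]
  exact le_antisymm (liminf_le_of_frequently_le hzero ⟨0, hnonneg⟩)
    (le_liminf_of_le (IsCoboundedUnder.of_frequently_le hzero) hnonneg)

theorem inner_nonneg_of_mem_tangentCone (hx : x ∈ C) {e : Pt d}
    (hC : ∀ y ∈ C, inner ℝ e x ≤ inner ℝ e y) (hv : v ∈ tangentCone C x) :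
    0 ≤ inner ℝ e v := by
  by_contra! hneg
  have he : 0 < ‖e‖ := norm_pos_iff.2 (by rintro rfl; simp at hneg)
  have hlow : ∀ᶠ s : ℝ in 𝓝[>] 0, -inner ℝ e v / ‖e‖ ≤ Metric.infDist (x + s • v) C / s := by
    filter_upwards [self_mem_nhdsWithin] with s (hs : 0 < s)
    rw [div_le_div_iff₀ he hs, ← div_le_iff₀ he]
    refine (Metric.le_infDist ⟨x, hx⟩).2 fun y hy => ?_
    have hcs := real_inner_le_norm e (y - (x + s • v))
    rw [inner_sub_right, inner_add_right, inner_smul_right] at hcs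
    rw [dist_comm, dist_eq_norm, div_le_iff₀' he]
    linarith [hC y hy]
  have hle := le_liminf_of_le
    (IsBoundedUnder.isCoboundedUnder_ge ⟨‖v‖, eventually_infDist_add_smul_div_le hx⟩) hlow
  rw [show liminf _ _ = _ from hv] at hle
  exact hle.not_gt (div_pos (neg_pos.2 hneg) he)

end TangentCone

namespace MultiDomain

variable {d : ℕ} (D : MultiDomain d)

/-- The signed distance to the hyperplane `ℋ_j`. -/
noncomputable def gap (j : Fin D.q) (x : Pt d) : ℝ := inner ℝ (D.normal j) x - D.offset j

theorem hasFDerivAt_gap (j : Fin D.q) (x : Pt d) :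
    HasFDerivAt (D.gap j) (innerSL ℝ (D.normal j)) x :=
  (innerSL ℝ (D.normal j)).hasFDerivAt.sub_const _

theorem contDiff_gap (j : Fin D.q) : ContDiff ℝ 1 (D.gap j) :=
  (innerSL ℝ (D.normal j)).contDiff.sub contDiff_const

theorem continuous_gap (j : Fin D.q) : Continuous (D.gap j) :=
  (D.contDiff_gap j).continuous

theorem gap_add_smul (j : Fin D.q) (x v : Pt d) (s : ℝ) :
    D.gap j (x + s • v) = D.gap j x + s * inner ℝ (D.normal j) v := by
  simp only [gap, inner_add_right, inner_smul_right]; ring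

theorem mem_stratum {σ : Fin D.q → SignType} {x : Pt d} :
    x ∈ D.stratum σ ↔ ∀ j, SignType.sign (D.gap j x) = σ j := Iff.rfl

theorem orthonormal_normal {p : Fin D.q → Prop} {x : Pt d} (h : ∀ j, p j → D.gap j x = 0) :
    Orthonormal ℝ fun j : {j // p j} => D.normal j := by
  refine ⟨fun j => D.norm_normal j, fun i j hij => ?_⟩
  refine (D.parallel_or_perp i j).resolve_left fun hpar => hij (Subtype.ext ?_)
  have hi := h i i.2
  have hj := h j j.2
  unfold gap at hi hj
  exact D.distinct i j hpar (by rw [hpar] at hi; linarith)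

theorem exists_inner_normal_eq (x : Pt d) (c : Fin D.q → ℝ) :
    ∃ w : Pt d, ∀ j, D.gap j x = 0 → inner ℝ (D.normal j) w = c j := by
  classical
  have hon := D.orthonormal_normal (p := fun j => D.gap j x = 0) fun _ h => h
  exact ⟨∑ j : {j // D.gap j x = 0}, c j • D.normal j, fun j hj =>
    hon.inner_right_fintype (fun i => c i) ⟨j, hj⟩⟩

theorem eventually_sign_gap_eq {j : Fin D.q} {x : Pt d} (hj : D.gap j x ≠ 0) :
    ∀ᶠ y in 𝓝 x, SignType.sign (D.gap j y) = SignType.sign (D.gap j x) :=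
  ((continuousAt_sign_of_ne_zero hj).comp (D.continuous_gap j).continuousAt).eventually_mem
    ((isOpen_discrete {SignType.sign (D.gap j x)}).mem_nhds rfl)

theorem sign_mul_gap_nonneg {σ : Fin D.q → SignType} {x : Pt d}
    (hx : x ∈ closure (D.stratum σ)) (j : Fin D.q) : 0 ≤ (σ j : ℝ) * D.gap j x := by
  have hclosed : IsClosed {x | 0 ≤ (σ j : ℝ) * D.gap j x} :=
    isClosed_le continuous_const (continuous_const.mul (D.continuous_gap j))
  refine closure_minimal (fun y hy => ?_) hclosed hx
  rw [mem_ofPred_eq, ← D.mem_stratum.1 hy j, sign_mul_self]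
  exact abs_nonneg _

theorem gap_eq_zero_of_mem_closure {σ : Fin D.q → SignType} {x : Pt d}
    (hx : x ∈ closure (D.stratum σ)) {j : Fin D.q} (hj : σ j = 0) : D.gap j x = 0 := by
  have hclosed : IsClosed {x | D.gap j x = 0} := isClosed_eq (D.continuous_gap j) continuous_const
  refine closure_minimal (fun y hy => ?_) hclosed hx
  rw [mem_ofPred_eq, ← sign_eq_zero_iff, D.mem_stratum.1 hy j, hj]

theorem sign_gap_eq_of_mem_closure_cell {τ : Fin D.q → SignType} (hτ : D.IsCell τ) {x : Pt d}
    (hx : x ∈ closure (D.stratum τ)) {j : Fin D.q} (hj : D.gap j x ≠ 0) :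
    SignType.sign (D.gap j x) = τ j :=
  sign_eq_of_cast_mul_nonneg (hτ j) hj (D.sign_mul_gap_nonneg hx j)

theorem mem_closure_cell_iff {τ : Fin D.q → SignType} (hτ : D.IsCell τ) {x : Pt d} :
    x ∈ closure (D.stratum τ) ↔ ∀ j, 0 ≤ (τ j : ℝ) * D.gap j x := by
  refine ⟨D.sign_mul_gap_nonneg, fun h => ?_⟩
  obtain ⟨w, hw⟩ := D.exists_inner_normal_eq x fun j => τ j
  refine mem_closure_of_tendsto (tendsto_add_smul_nhdsGT_zero x w) (eventually_all.2 fun j => ?_)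
  by_cases hj : D.gap j x = 0
  · filter_upwards [self_mem_nhdsWithin] with s (hs : 0 < s)
    rw [← gap, gap_add_smul, hj, zero_add, hw j hj, sign_mul, sign_pos hs, sign_coe, one_mul]
  · filter_upwards [(tendsto_add_smul_nhdsGT_zero x w).eventually
      (D.eventually_sign_gap_eq hj)] with s hs
    exact hs.trans (sign_eq_of_cast_mul_nonneg (hτ j) hj (h j))

/-- The sign vector of a cell whose closure contains the stratum `σ`: the hyperplanes containing
the stratum are replaced by their positive sides. -/
def cellSign (σ : Fin D.q → SignType) (j : Fin D.q) : SignType := if σ j = 0 then 1 else σ j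

theorem isCell_cellSign (σ : Fin D.q → SignType) : D.IsCell (D.cellSign σ) := by
  intro j
  unfold cellSign
  split_ifs with h
  · exact one_ne_zero
  · exact h

theorem closure_stratum_subset_closure_cellSign (σ : Fin D.q → SignType) :
    closure (D.stratum σ) ⊆ closure (D.stratum (D.cellSign σ)) := by
  intro x hx
  refine (D.mem_closure_cell_iff (D.isCell_cellSign σ)).2 fun j => ?_
  by_cases h : σ j = 0
  · rw [D.gap_eq_zero_of_mem_closure hx h, mul_zero]
  · simpa only [cellSign, h, if_false] using D.sign_mul_gap_nonneg hx j

theorem exists_cell_mem_closure (x : Pt d) : ∃ τ, D.IsCell τ ∧ x ∈ closure (D.stratum τ) :=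
  ⟨_, D.isCell_cellSign _, D.closure_stratum_subset_closure_cellSign
    (fun j => SignType.sign (D.gap j x)) (subset_closure fun _ => rfl)⟩

theorem mem_tangentCone_closure_cell {τ : Fin D.q → SignType} (hτ : D.IsCell τ) {x v : Pt d}
    (hx : x ∈ closure (D.stratum τ))
    (h : ∀ j, D.gap j x = 0 → 0 ≤ (τ j : ℝ) * inner ℝ (D.normal j) v) :
    v ∈ tangentCone (closure (D.stratum τ)) x := by
  apply mem_tangentCone_of_frequently_mem
  simp only [D.mem_closure_cell_iff hτ]
  refine (eventually_all.2 fun j => ?_).frequently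
  by_cases hj : D.gap j x = 0
  · filter_upwards [self_mem_nhdsWithin] with s (hs : 0 < s)
    rw [gap_add_smul, hj, zero_add, mul_left_comm]
    exact mul_nonneg hs.le (h j hj)
  · filter_upwards [(tendsto_add_smul_nhdsGT_zero x v).eventually
      (D.eventually_sign_gap_eq hj)] with s hs
    rw [← D.sign_gap_eq_of_mem_closure_cell hτ hx hj, ← hs, sign_mul_self]
    exact abs_nonneg _

theorem exists_cell_mem_tangentCone (x v : Pt d) :
    ∃ τ, D.IsCell τ ∧ x ∈ closure (D.stratum τ) ∧ v ∈ tangentCone (closure (D.stratum τ)) x := by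
  obtain ⟨τ, hτ⟩ : ∃ τ, ∃ᶠ s : ℝ in 𝓝[>] 0, D.IsCell τ ∧ x + s • v ∈ closure (D.stratum τ) :=
    frequently_exists.1 (Frequently.of_forall fun s => D.exists_cell_mem_closure (x + s • v))
  obtain ⟨_, hcell, -⟩ := hτ.exists
  have hmem := hτ.mono fun s hs => hs.2
  exact ⟨τ, hcell,
    isClosed_closure.mem_of_frequently_of_tendsto hmem (tendsto_add_smul_nhdsGT_zero x v),
    mem_tangentCone_of_frequently_mem hmem⟩

theorem sign_mul_inner_nonneg_of_mem_tangentCone {σ : Fin D.q → SignType} {x v : Pt d}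
    (hx : x ∈ closure (D.stratum σ)) (hv : v ∈ tangentCone (closure (D.stratum σ)) x)
    {j : Fin D.q} (hj : D.gap j x = 0) : 0 ≤ (σ j : ℝ) * inner ℝ (D.normal j) v := by
  rw [← real_inner_smul_left]
  refine inner_nonneg_of_mem_tangentCone hx (fun y hy => ?_) hv
  have hy' := D.sign_mul_gap_nonneg hy j
  rw [gap, mul_sub, ← sub_eq_zero.1 hj] at hy'
  simpa only [real_inner_smul_left] using sub_nonneg.1 hy'

theorem inner_eq_zero_of_mem_tangentCone {σ : Fin D.q → SignType} {x v : Pt d}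
    (hx : x ∈ closure (D.stratum σ)) (hv : v ∈ tangentCone (closure (D.stratum σ)) x)
    {j : Fin D.q} (hj : σ j = 0) : inner ℝ (D.normal j) v = (0 : ℝ) := by
  have hconst : ∀ y ∈ closure (D.stratum σ), inner ℝ (D.normal j) x = inner ℝ (D.normal j) y :=
    fun y hy => (sub_eq_zero.1 (D.gap_eq_zero_of_mem_closure hx hj)).trans
      (sub_eq_zero.1 (D.gap_eq_zero_of_mem_closure hy hj)).symm
  have hneg : 0 ≤ inner ℝ (-D.normal j) v :=
    inner_nonneg_of_mem_tangentCone hx (fun y hy => by simp only [inner_neg_left, hconst y hy,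
      le_refl]) hv
  rw [inner_neg_left] at hneg
  exact le_antisymm (neg_nonneg.1 hneg)
    (inner_nonneg_of_mem_tangentCone hx (fun y hy => (hconst y hy).le) hv)

/-- The intersection of the hyperplanes containing the stratum `σ`; it is the affine hull of the
stratum when the latter is nonempty. -/
def flat (σ : Fin D.q → SignType) : Set (Pt d) := {x | ∀ j, σ j = 0 → D.gap j x = 0}

theorem closure_stratum_subset_flat (σ : Fin D.q → SignType) :
    closure (D.stratum σ) ⊆ D.flat σ := fun _ hx _ hj => D.gap_eq_zero_of_mem_closure hx hj

/-- The linear part of the orthogonal projection to the flat of the stratum `σ`. -/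
noncomputable def projLin (σ : Fin D.q → SignType) : Pt d →L[ℝ] Pt d :=
  ContinuousLinearMap.id ℝ (Pt d) -
    ∑ j : {j // σ j = 0}, (innerSL ℝ (D.normal j)).smulRight (D.normal j)

/-- The orthogonal projection to the flat of the stratum `σ`. -/
noncomputable def proj (σ : Fin D.q → SignType) (x : Pt d) : Pt d :=
  x - ∑ j : {j // σ j = 0}, D.gap j x • D.normal j

theorem hasFDerivAt_proj (σ : Fin D.q → SignType) (x : Pt d) :
    HasFDerivAt (D.proj σ) (D.projLin σ) x :=
  (hasFDerivAt_id x).fun_sub (HasFDerivAt.fun_sum fun j _ =>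
    (D.hasFDerivAt_gap j x).smul_const (D.normal j))

theorem continuous_proj (σ : Fin D.q → SignType) : Continuous (D.proj σ) :=
  continuous_iff_continuousAt.2 fun x => (D.hasFDerivAt_proj σ x).continuousAt

theorem proj_eq_self {σ : Fin D.q → SignType} {x : Pt d} (hx : x ∈ D.flat σ) :
    D.proj σ x = x := by
  rw [proj, Finset.sum_eq_zero fun j _ => by rw [hx j j.2, zero_smul], sub_zero]

theorem projLin_eq_self {σ : Fin D.q → SignType} {v : Pt d}
    (h : ∀ j, σ j = 0 → inner ℝ (D.normal j) v = (0 : ℝ)) : D.projLin σ v = v := by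
  simp only [projLin, sub_apply, ContinuousLinearMap.id_apply,
    sum_apply, ContinuousLinearMap.smulRight_apply, innerSL_apply_apply]
  rw [Finset.sum_eq_zero fun j _ => by rw [h j j.2, zero_smul], sub_zero]

theorem gap_proj (σ : Fin D.q → SignType) (i : Fin D.q) (x : Pt d) :
    D.gap i (D.proj σ x) =
      D.gap i x - inner ℝ (D.normal i) (∑ j : {j // σ j = 0}, D.gap j x • D.normal j) := by
  simp only [proj, gap, inner_sub_right]
  ring

theorem proj_mem_flat {σ : Fin D.q → SignType} (hne : (D.flat σ).Nonempty) (x : Pt d) :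
    D.proj σ x ∈ D.flat σ := by
  obtain ⟨y, hy⟩ := hne
  intro i hi
  rw [gap_proj, (D.orthonormal_normal hy).inner_right_fintype (fun j => D.gap j x) ⟨i, hi⟩,
    sub_self]

theorem mapsTo_proj {σ : Fin D.q → SignType} (hne : (D.stratum σ).Nonempty) :
    MapsTo (D.proj σ) (D.stratum (D.cellSign σ)) (D.stratum σ) := by
  obtain ⟨y, hy⟩ := hne
  have hyflat : y ∈ D.flat σ := D.closure_stratum_subset_flat σ (subset_closure hy)
  intro x hx
  have hflat := D.proj_mem_flat ⟨y, hyflat⟩ x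
  refine D.mem_stratum.2 fun i => ?_
  by_cases hi : σ i = 0
  · rw [hflat i hi, hi, sign_zero]
  by_cases hpar : ∃ j, σ j = 0 ∧ D.normal i = D.normal j
  · obtain ⟨j, hj, hij⟩ := hpar
    have hj' : inner ℝ (D.normal j) (D.proj σ x) = inner ℝ (D.normal j) y :=
      (sub_eq_zero.1 (hflat j hj)).trans (sub_eq_zero.1 (hyflat j hj)).symm
    rw [← D.mem_stratum.1 hy i, gap, gap, hij, hj']
  · push Not at hpar
    have hperp : inner ℝ (D.normal i) (∑ j : {j // σ j = 0}, D.gap j x • D.normal j) = (0 : ℝ) := by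
      rw [inner_sum]
      refine Finset.sum_eq_zero fun j _ => ?_
      rw [inner_smul_right, (D.parallel_or_perp i j).resolve_left (hpar j j.2), mul_zero]
    rw [gap_proj, hperp, sub_zero, D.mem_stratum.1 hx i, cellSign, if_neg hi]

/-- The sum of the squared distances to the hyperplanes containing the stratum `σ`, used to penalize
the distance to its flat. -/
noncomputable def flatPenalty (σ : Fin D.q → SignType) (x : Pt d) : ℝ :=
  ∑ j : {j // σ j = 0}, D.gap j x ^ 2

theorem flatPenalty_nonneg (σ : Fin D.q → SignType) (x : Pt d) : 0 ≤ D.flatPenalty σ x :=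
  Finset.sum_nonneg fun _ _ => sq_nonneg _

theorem flatPenalty_eq_zero_iff {σ : Fin D.q → SignType} {x : Pt d} :
    D.flatPenalty σ x = 0 ↔ x ∈ D.flat σ := by
  simp [flatPenalty, flat, Finset.sum_eq_zero_iff_of_nonneg fun _ _ => sq_nonneg _]

theorem contDiff_flatPenalty (σ : Fin D.q → SignType) : ContDiff ℝ 1 (D.flatPenalty σ) :=
  ContDiff.sum fun j _ => (D.contDiff_gap j).pow 2

theorem fderiv_flatPenalty_apply (σ : Fin D.q → SignType) (x v : Pt d) :
    fderiv ℝ (D.flatPenalty σ) x v =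
      ∑ j : {j // σ j = 0}, 2 * (D.gap j x * inner ℝ (D.normal j) v) := by
  have h : HasFDerivAt (D.flatPenalty σ) _ x :=
    HasFDerivAt.fun_sum fun j _ => (D.hasFDerivAt_gap j x).pow 2
  simp [h.fderiv, mul_assoc]

end MultiDomain

section HausdorffContinuity

attribute [local instance] PseudoEMetricSpace.hausdorff

theorem lowerHemicontinuous_of_continuous_hausdorff {X Y : Type*} [TopologicalSpace X]
    [PseudoEMetricSpace Y] {Φ : X → Set Y} (hΦ : Continuous Φ) : LowerHemicontinuous Φ := by
  rintro x U ⟨hU, v, hv, hvU⟩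
  obtain ⟨ε, hε, hball⟩ := EMetric.isOpen_iff.1 hU v hvU
  filter_upwards [EMetric.tendsto_nhds.1 (hΦ.tendsto x) ε hε] with y hy
  rw [edist_comm] at hy
  obtain ⟨w, hw, hvw⟩ := Metric.exists_edist_lt_of_hausdorffEDist_lt hv hy
  exact ⟨hU, w, hw, hball (by rwa [edist_comm] at hvw)⟩

variable {d N : ℕ}

theorem LipschitzOnBalls.continuousOn {Y : Type*} [PseudoEMetricSpace Y] {K : ℝ → ℝ≥0}
    {S : Set (Pt d)} {Φ : Pt d → Set Y} (h : LipschitzOnBalls K S Φ) : ContinuousOn Φ S := by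
  intro x hx
  have hball : Metric.closedBall 0 (‖x‖ + 1) ∈ 𝓝 x :=
    mem_of_superset (Metric.ball_mem_nhds x one_pos) fun y hy => by
      rw [mem_closedBall_zero_iff]
      rw [mem_ball_iff_norm] at hy
      linarith [norm_sub_norm_le y x]
  have hlip : LipschitzOnWith (K (‖x‖ + 1)) Φ (S ∩ Metric.closedBall 0 (‖x‖ + 1)) :=
    fun y hy z hz => h _ y hy z hz
  exact (continuousWithinAt_inter hball).1 (hlip.continuousOn x ⟨hx, mem_of_mem_nhds hball⟩)

theorem MultiDomain.continuous_of_continuousOn_cell (D : MultiDomain d) {Y : Type*}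
    [TopologicalSpace Y] {Φ : Pt d → Y}
    (h : ∀ σ, D.IsCell σ → ContinuousOn Φ (closure (D.stratum σ))) : Continuous Φ :=
  (locallyFinite_of_finite fun σ : {σ // D.IsCell σ} => closure (D.stratum σ)).continuous
    (iUnion_eq_univ_iff.2 fun x => by simpa using D.exists_cell_mem_closure x)
    (fun _ => isClosed_closure) fun σ => h σ σ.2

variable {D : MultiDomain d} {𝒜 : Set (Pt N)} {f : Pt d → Pt N → Pt d} {ℓ : Pt d → Pt N → ℝ}
  {cf cl lam : ℝ} {K : ℝ → ℝ≥0}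

theorem HF.lowerHemicontinuous (hF : HF D 𝒜 f cf K) : LowerHemicontinuous (dyn 𝒜 f) :=
  lowerHemicontinuous_of_continuous_hausdorff
    (D.continuous_of_continuousOn_cell fun σ hσ => (hF.lipschitz σ hσ).continuousOn)

theorem AugLipschitz.continuous (hG : AugLipschitz D 𝒜 f ℓ cl lam) :
    Continuous (augDyn 𝒜 f ℓ cl lam) :=
  D.continuous_of_continuousOn_cell fun σ hσ => (hG.choose_spec σ hσ).continuousOn

end HausdorffContinuity

section EssentialControls

variable {d N : ℕ} {D : MultiDomain d} {𝒜 : Set (Pt N)} {f : Pt d → Pt N → Pt d}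

theorem mem_dynExt_of_lowerHemicontinuousAt {M : Set (Pt d)} {x v : Pt d}
    (hF : LowerHemicontinuousAt (dyn 𝒜 f) x) (hv : v ∈ dyn 𝒜 f x) : v ∈ dynExt 𝒜 f M x := by
  refine Metric.tendsto_nhds.2 fun ε hε => Eventually.filter_mono nhdsWithin_le_nhds ?_
  filter_upwards [hF (Metric.ball v ε) ⟨Metric.isOpen_ball, v, hv, Metric.mem_ball_self hε⟩]
    with y ⟨_, w, hw, hwv⟩
  rw [Real.dist_0_eq_abs, abs_of_nonneg Metric.infDist_nonneg]
  exact (Metric.infDist_le_dist_of_mem hw).trans_lt (Metric.mem_ball'.1 hwv)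

theorem mem_essCtrlOn_cell {τ : Fin D.q → SignType} (hτ : D.IsCell τ) {x : Pt d}
    (hF : LowerHemicontinuousAt (dyn 𝒜 f) x) (hx : x ∈ closure (D.stratum τ)) {a : Pt N}
    (ha : a ∈ 𝒜) (h : ∀ j, D.gap j x = 0 → 0 ≤ (τ j : ℝ) * inner ℝ (D.normal j) (f x a)) :
    a ∈ essCtrlOn 𝒜 f (D.stratum τ) x :=
  ⟨ha, mem_dynExt_of_lowerHemicontinuousAt hF (mem_image_of_mem _ ha),
    D.mem_tangentCone_closure_cell hτ hx h⟩

theorem essCtrl_subset (x : Pt d) : essCtrl D 𝒜 f x ⊆ 𝒜 := fun _ ⟨_, _, ha, _⟩ => ha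

theorem essCtrl_eq_of_lowerHemicontinuousAt {x : Pt d}
    (hF : LowerHemicontinuousAt (dyn 𝒜 f) x) : essCtrl D 𝒜 f x = 𝒜 := by
  refine (essCtrl_subset x).antisymm fun a ha => ?_
  obtain ⟨τ, -, hx, hv⟩ := D.exists_cell_mem_tangentCone x (f x a)
  exact ⟨τ, hx, ha, mem_dynExt_of_lowerHemicontinuousAt hF (mem_image_of_mem _ ha), hv⟩

end EssentialControls

theorem eventually_forall_dist_lt_of_tendstoLocallyUniformlyOn {ι X A Y : Type*}
    [TopologicalSpace X] [LocallyCompactSpace X] [TopologicalSpace A] [PseudoMetricSpace Y]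
    {l : Filter ι} {𝒜 : Set A} (h𝒜 : IsCompact 𝒜) {gn : ι → X → A → Y} {g : X → A → Y}
    (h : TendstoLocallyUniformlyOn (fun n (z : X × A) => gn n z.1 z.2) (fun z => g z.1 z.2) l
      (univ ×ˢ 𝒜)) {xn : ι → X} {x₀ : X} (hxn : Tendsto xn l (𝓝 x₀)) {ε : ℝ} (hε : 0 < ε) :
    ∀ᶠ n in l, ∀ a ∈ 𝒜, dist (g (xn n) a) (gn n (xn n) a) < ε := by
  obtain ⟨B, hB, hBx₀⟩ := exists_compact_mem_nhds x₀
  have hunif := (tendstoLocallyUniformlyOn_iff_tendstoUniformlyOn_of_compact (hB.prod h𝒜)).1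
    (h.mono (prod_mono_left (subset_univ _)))
  filter_upwards [Metric.tendstoUniformlyOn_iff.1 hunif ε hε, hxn hBx₀] with n hn hx a ha
  exact hn (xn n, a) ⟨hx, ha⟩

section Controls

variable {d N : ℕ} {D : MultiDomain d} {𝒜 : Set (Pt N)} {f : Pt d → Pt N → Pt d}
  {ℓ : Pt d → Pt N → ℝ} {cl lam : ℝ}

theorem mem_augDyn {x : Pt d} {a : Pt N} (ha : a ∈ 𝒜) (hℓ : ℓ x a ≤ cl * (1 + ‖x‖ ^ lam)) :
    (f x a, -ℓ x a) ∈ augDyn 𝒜 f ℓ cl lam x :=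
  ⟨a, ha, 0, le_rfl, sub_nonneg.2 hℓ, by rw [sub_zero]⟩

theorem lowerHemicontinuous_dyn (hℓ : ∀ x, ∀ a ∈ 𝒜, ℓ x a ≤ cl * (1 + ‖x‖ ^ lam))
    (hG : LowerHemicontinuous (augDyn 𝒜 f ℓ cl lam)) : LowerHemicontinuous (dyn 𝒜 f) := by
  rintro x U ⟨hU, _, ⟨a, ha, rfl⟩, haU⟩
  filter_upwards [hG x (U ×ˢ univ) ⟨hU.prod isOpen_univ, _, mem_augDyn ha (hℓ x a ha),
    haU, mem_univ _⟩] with y ⟨_, _, ⟨b, hb, _, _, _, rfl⟩, hbU, _⟩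
  exact ⟨hU, _, mem_image_of_mem _ hb, hbU⟩

theorem exists_control_of_hausdorffEDist_lt {x y : Pt d} {ε : ℝ}
    (h : Metric.hausdorffEDist (augDyn 𝒜 f ℓ cl lam x) (augDyn 𝒜 f ℓ cl lam y) < ENNReal.ofReal ε)
    {a : Pt N} (ha : a ∈ 𝒜) (hℓ : ℓ x a ≤ cl * (1 + ‖x‖ ^ lam)) :
    ∃ b ∈ 𝒜, ‖f y b - f x a‖ < ε ∧ ℓ y b < ℓ x a + ε := by
  obtain ⟨z, ⟨b, hb, r, hr, _, rfl⟩, hlt⟩ :=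
    Metric.exists_edist_lt_of_hausdorffEDist_lt (mem_augDyn (f := f) ha hℓ) h
  rw [edist_dist, ENNReal.ofReal_lt_ofReal_iff (ENNReal.ofReal_pos.1 (pos_of_gt h)), Prod.dist_eq,
    max_lt_iff, dist_comm, dist_eq_norm, Real.dist_eq] at hlt
  exact ⟨b, hb, hlt.1, by linarith [(abs_lt.1 hlt.2).2]⟩

attribute [local instance] PseudoEMetricSpace.hausdorff

theorem eventually_exists_control (hℓ : ∀ x, ∀ a ∈ 𝒜, ℓ x a ≤ cl * (1 + ‖x‖ ^ lam))
    (hG : Continuous (augDyn 𝒜 f ℓ cl lam)) (x₀ : Pt d) {ε : ℝ} (hε : 0 < ε) :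
    ∀ᶠ x in 𝓝 x₀, (∀ a ∈ 𝒜, ∃ b ∈ 𝒜, ‖f x b - f x₀ a‖ < ε ∧ ℓ x b < ℓ x₀ a + ε) ∧
      ∀ a ∈ 𝒜, ∃ b ∈ 𝒜, ‖f x₀ b - f x a‖ < ε ∧ ℓ x₀ b < ℓ x a + ε := by
  filter_upwards [EMetric.tendsto_nhds.1 (hG.tendsto x₀) _ (ENNReal.ofReal_pos.2 hε)] with x hx
  refine ⟨fun a ha => exists_control_of_hausdorffEDist_lt ?_ ha (hℓ x₀ a ha),
    fun a ha => exists_control_of_hausdorffEDist_lt hx ha (hℓ x a ha)⟩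
  rwa [Metric.hausdorffEDist_comm]

variable {ι : Type*} {l : Filter ι} {fn : ι → Pt d → Pt N → Pt d} {ℓn : ι → Pt d → Pt N → ℝ}
  {xn : ι → Pt d} {x₀ : Pt d}

theorem eventually_exists_control_of_tendsto (h𝒜 : IsCompact 𝒜)
    (hℓ : ∀ x, ∀ a ∈ 𝒜, ℓ x a ≤ cl * (1 + ‖x‖ ^ lam)) (hG : Continuous (augDyn 𝒜 f ℓ cl lam))
    (hfn : TendstoLocallyUniformlyOn (fun n (z : Pt d × Pt N) => fn n z.1 z.2)
      (fun z => f z.1 z.2) l (univ ×ˢ 𝒜))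
    (hℓn : TendstoLocallyUniformlyOn (fun n (z : Pt d × Pt N) => ℓn n z.1 z.2)
      (fun z => ℓ z.1 z.2) l (univ ×ˢ 𝒜))
    (hxn : Tendsto xn l (𝓝 x₀)) {ε : ℝ} (hε : 0 < ε) :
    ∀ᶠ n in l,
      (∀ a ∈ 𝒜, ∃ b ∈ 𝒜, ‖fn n (xn n) b - f x₀ a‖ < ε ∧ ℓn n (xn n) b < ℓ x₀ a + ε) ∧
      ∀ a ∈ 𝒜, ∃ b ∈ 𝒜, ‖f x₀ b - fn n (xn n) a‖ < ε ∧ ℓ x₀ b < ℓn n (xn n) a + ε := by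
  filter_upwards [hxn.eventually (eventually_exists_control hℓ hG x₀ (half_pos hε)),
    eventually_forall_dist_lt_of_tendstoLocallyUniformlyOn h𝒜 hfn hxn (half_pos hε),
    eventually_forall_dist_lt_of_tendstoLocallyUniformlyOn h𝒜 hℓn hxn (half_pos hε)]
    with n ⟨hto, hfrom⟩ hf hl
  simp only [dist_eq_norm] at hf hl
  refine ⟨fun a ha => ?_, fun a ha => ?_⟩
  · obtain ⟨b, hb, hfb, hℓb⟩ := hto a ha
    refine ⟨b, hb, ?_, by linarith [(abs_lt.1 (hl b hb)).1]⟩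
    have htri := norm_sub_le_norm_sub_add_norm_sub (fn n (xn n) b) (f (xn n) b) (f x₀ a)
    rw [norm_sub_rev (fn n (xn n) b) (f (xn n) b)] at htri
    linarith [hf b hb]
  · obtain ⟨b, hb, hfb, hℓb⟩ := hfrom a ha
    refine ⟨b, hb, ?_, by linarith [(abs_lt.1 (hl a ha)).2]⟩
    linarith [hf a ha, norm_sub_le_norm_sub_add_norm_sub (f x₀ b) (f (xn n) a) (fn n (xn n) a)]

end Controls

section Push

attribute [local instance] PseudoEMetricSpace.hausdorff

variable {d N : ℕ} {D : MultiDomain d} {𝒜 : Set (Pt N)} {f : Pt d → Pt N → Pt d}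
  {ℓ : Pt d → Pt N → ℝ} {cl lam : ℝ}

theorem HG.exists_eq_lineMap (hG : HG 𝒜 f ℓ cl lam) {x : Pt d}
    (hℓ : ∀ a ∈ 𝒜, ℓ x a ≤ cl * (1 + ‖x‖ ^ lam)) {a b : Pt N} (ha : a ∈ 𝒜) (hb : b ∈ 𝒜)
    {θ : ℝ} (hθ : θ ∈ Icc (0 : ℝ) 1) :
    ∃ c ∈ 𝒜, f x c = AffineMap.lineMap (f x a) (f x b) θ ∧
      ℓ x c ≤ AffineMap.lineMap (ℓ x a) (ℓ x b) θ := by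
  obtain ⟨c, hc, r, hr, -, hcr⟩ :=
    (hG x).lineMap_mem (mem_augDyn ha (hℓ a ha)) (mem_augDyn hb (hℓ b hb)) hθ
  have hf := congrArg Prod.fst hcr
  have hl := congrArg Prod.snd hcr
  simp only [AffineMap.fst_lineMap, AffineMap.snd_lineMap] at hf hl
  refine ⟨c, hc, hf.symm, ?_⟩
  rw [AffineMap.lineMap_apply_ring] at hl ⊢
  linarith

theorem H2.exists_control_eq_smul (h2 : H2 D 𝒜 f) {x : Pt d} (hx : x ∈ D.interface) (w : Pt d) :
    ∃ η : ℝ, 0 < η ∧ ∃ b ∈ 𝒜, f x b = η • w := by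
  obtain ⟨r₁, hr₁, hball⟩ := h2
  have hsmall : ∀ᶠ η : ℝ in 𝓝[>] 0, η • w ∈ Metric.ball (0 : Pt d) r₁ := by
    simpa only [zero_add] using
      (tendsto_add_smul_nhdsGT_zero 0 w).eventually_mem (Metric.ball_mem_nhds 0 hr₁)
  obtain ⟨η, hη, hη0⟩ := (hsmall.and self_mem_nhdsWithin).exists
  exact ⟨η, hη0, hball x hx hη⟩

theorem exists_control_strict_side (hℓ : ∀ x, ∀ a ∈ 𝒜, ℓ x a ≤ cl * (1 + ‖x‖ ^ lam))
    (hconv : HG 𝒜 f ℓ cl lam) (h2 : H2 D 𝒜 f) {x : Pt d} {a : Pt N} (ha : a ∈ 𝒜)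
    {s : Fin D.q → SignType} (hs : D.IsCell s)
    (hside : ∀ j, D.gap j x = 0 → 0 ≤ (s j : ℝ) * inner ℝ (D.normal j) (f x a))
    {ε : ℝ} (hε : 0 < ε) :
    ∃ b ∈ 𝒜, ‖f x b - f x a‖ < ε ∧ ℓ x b < ℓ x a + ε ∧
      ∀ j, D.gap j x = 0 → 0 < (s j : ℝ) * inner ℝ (D.normal j) (f x b) := by
  by_cases hx : x ∈ D.interface
  swap
  · have hgap : ∀ j, D.gap j x ≠ 0 := fun j hj => hx (mem_iUnion.2 ⟨j, sub_eq_zero.1 hj⟩)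
    exact ⟨a, ha, by simpa using hε, by linarith, fun j hj => absurd hj (hgap j)⟩
  -- `w` points strictly to the side `s` of every hyperplane through `x`; (H2) realizes a positive
  -- multiple of it, which by convexity of `G` can be mixed with `f x a` in a small proportion.
  obtain ⟨w, hw⟩ := D.exists_inner_normal_eq x fun j => s j
  obtain ⟨η, hη, b, hb, hbw⟩ := h2.exists_control_eq_smul hx w
  have hclose : ∀ᶠ θ : ℝ in 𝓝[>] 0, ‖AffineMap.lineMap (f x a) (f x b) θ - f x a‖ < ε ∧
      AffineMap.lineMap (ℓ x a) (ℓ x b) θ < ℓ x a + ε := by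
    filter_upwards [(tendsto_lineMap_nhdsGT_zero (f x a) (f x b)).eventually_mem
      (Metric.ball_mem_nhds _ hε), (tendsto_lineMap_nhdsGT_zero (ℓ x a) (ℓ x b)).eventually_mem
      (gt_mem_nhds (lt_add_of_pos_right _ hε))] with θ hθf hθl
    exact ⟨mem_ball_iff_norm.1 hθf, hθl⟩
  obtain ⟨θ, ⟨hθf, hθl⟩, hθ0, hθ1⟩ :=
    (hclose.and (Ioo_mem_nhdsGT (zero_lt_one' ℝ))).exists
  obtain ⟨c, hc, hcf, hcl⟩ := hconv.exists_eq_lineMap (hℓ x) ha hb ⟨hθ0.le, hθ1.le⟩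
  refine ⟨c, hc, hcf ▸ hθf, hcl.trans_lt hθl, fun j hj => ?_⟩
  rw [hcf, hbw, AffineMap.lineMap_apply_module, inner_add_right, inner_smul_right,
    inner_smul_right, inner_smul_right, hw j hj]
  have hsj : 0 < (s j : ℝ) * s j :=
    mul_self_pos.2 fun h => hs j (by rw [← sign_coe (s j), h, sign_zero])
  have hfirst := mul_nonneg (sub_nonneg.2 hθ1.le) (hside j hj)
  have hsecond := mul_pos (mul_pos hθ0 hη) hsj
  linarith

variable {ι : Type*} {l : Filter ι} {fn : ι → Pt d → Pt N → Pt d} {ℓn : ι → Pt d → Pt N → ℝ}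
  {xn : ι → Pt d} {x₀ : Pt d} {a : Pt N}

theorem eventually_exists_control_strict_side (h𝒜 : IsCompact 𝒜)
    (hℓ : ∀ x, ∀ a ∈ 𝒜, ℓ x a ≤ cl * (1 + ‖x‖ ^ lam)) (hconv : HG 𝒜 f ℓ cl lam)
    (hG : Continuous (augDyn 𝒜 f ℓ cl lam)) (h2 : H2 D 𝒜 f)
    (hfn : TendstoLocallyUniformlyOn (fun n (z : Pt d × Pt N) => fn n z.1 z.2)
      (fun z => f z.1 z.2) l (univ ×ˢ 𝒜))
    (hℓn : TendstoLocallyUniformlyOn (fun n (z : Pt d × Pt N) => ℓn n z.1 z.2)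
      (fun z => ℓ z.1 z.2) l (univ ×ˢ 𝒜))
    (hxn : Tendsto xn l (𝓝 x₀)) (ha : a ∈ 𝒜) {s : Fin D.q → SignType} (hs : D.IsCell s)
    (hside : ∀ j, D.gap j x₀ = 0 → 0 ≤ (s j : ℝ) * inner ℝ (D.normal j) (f x₀ a))
    {ε : ℝ} (hε : 0 < ε) :
    ∀ᶠ n in l, ∃ b ∈ 𝒜, ‖fn n (xn n) b - f x₀ a‖ < ε ∧ ℓn n (xn n) b < ℓ x₀ a + ε ∧
      ∀ j, D.gap j x₀ = 0 → 0 < (s j : ℝ) * inner ℝ (D.normal j) (fn n (xn n) b) := by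
  obtain ⟨a', ha', hfa', hℓa', hstrict⟩ :=
    exists_control_strict_side hℓ hconv h2 ha hs hside (half_pos hε)
  have hnear : ∀ᶠ v in 𝓝 (f x₀ a'), ‖v - f x₀ a‖ < ε ∧
      ∀ j, D.gap j x₀ = 0 → 0 < (s j : ℝ) * inner ℝ (D.normal j) v := by
    refine .and ?_ (eventually_all.2 fun j => eventually_imp_distrib_left.2 fun hj => ?_)
    · exact ContinuousAt.eventually_lt (by fun_prop) continuousAt_const (by linarith)
    · exact ContinuousAt.eventually_lt continuousAt_const (by fun_prop) (hstrict j hj)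
  obtain ⟨κ, hκ, hball⟩ := Metric.eventually_nhds_iff.1 hnear
  filter_upwards [eventually_exists_control_of_tendsto h𝒜 hℓ hG hfn hℓn hxn
    (lt_min hκ (half_pos hε))] with n ⟨hn, _⟩
  obtain ⟨b, hb, hfb, hℓb⟩ := hn a' ha'
  obtain ⟨hclose, hpos⟩ :=
    hball ((dist_eq_norm _ _).trans_lt (hfb.trans_le (min_le_left _ _)))
  exact ⟨b, hb, hclose, by linarith [min_le_right κ (ε / 2)], hpos⟩

/-- The side of each hyperplane towards which a velocity at `y`, a point of the closed cell
`cellSign σ`, is to be pushed: into the cell on the hyperplanes through `y`, and back to the flat of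
`σ` from the hyperplanes that contain this flat but not `y`. -/
noncomputable def MultiDomain.pushSign (D : MultiDomain d) (σ : Fin D.q → SignType) (y : Pt d)
    (j : Fin D.q) : SignType :=
  if σ j = 0 then if D.gap j y = 0 then 1 else -1 else σ j

theorem MultiDomain.isCell_pushSign (D : MultiDomain d) (σ : Fin D.q → SignType) (y : Pt d) :
    D.IsCell (D.pushSign σ y) := by
  intro j
  unfold pushSign
  split_ifs with hσ <;> first | exact hσ | decide

theorem MultiDomain.pushSign_eq_cellSign (D : MultiDomain d) (σ : Fin D.q → SignType) {y : Pt d}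
    {j : Fin D.q} (hj : D.gap j y = 0) : D.pushSign σ y j = D.cellSign σ j := by
  simp only [pushSign, cellSign, if_pos hj]

theorem MultiDomain.fderiv_flatPenalty_nonpos (D : MultiDomain d) {σ : Fin D.q → SignType}
    {y v : Pt d} (hy : y ∈ closure (D.stratum (D.cellSign σ)))
    (h : ∀ j, σ j = 0 → 0 ≤ (D.pushSign σ y j : ℝ) * inner ℝ (D.normal j) v) :
    fderiv ℝ (D.flatPenalty σ) y v ≤ 0 := by
  rw [fderiv_flatPenalty_apply]
  refine Finset.sum_nonpos fun ⟨j, hj⟩ _ => ?_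
  have hgap := D.sign_mul_gap_nonneg hy j
  have hpush := h j hj
  rw [cellSign, if_pos hj, SignType.coe_one, one_mul] at hgap
  by_cases hjy : D.gap j y = 0
  · simp [hjy]
  · rw [pushSign, if_pos hj, if_neg hjy, SignType.coe_neg_one, neg_one_mul] at hpush
    nlinarith

theorem MultiDomain.eventually_gap_eq_zero_imp (D : MultiDomain d) (hxn : Tendsto xn l (𝓝 x₀)) :
    ∀ᶠ n in l, ∀ j, D.gap j (xn n) = 0 → D.gap j x₀ = 0 := by
  refine eventually_all.2 fun j => ?_
  by_cases hj : D.gap j x₀ = 0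
  · exact Eventually.of_forall fun _ _ => hj
  · filter_upwards [((D.continuous_gap j).tendsto x₀).comp hxn |>.eventually_ne hj]
      with n hn h0 using absurd h0 hn

theorem eventually_exists_control_pushSign (h𝒜 : IsCompact 𝒜)
    (hℓ : ∀ x, ∀ a ∈ 𝒜, ℓ x a ≤ cl * (1 + ‖x‖ ^ lam)) (hconv : HG 𝒜 f ℓ cl lam)
    (hG : Continuous (augDyn 𝒜 f ℓ cl lam)) (h2 : H2 D 𝒜 f)
    (hfn : TendstoLocallyUniformlyOn (fun n (z : Pt d × Pt N) => fn n z.1 z.2)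
      (fun z => f z.1 z.2) l (univ ×ˢ 𝒜))
    (hℓn : TendstoLocallyUniformlyOn (fun n (z : Pt d × Pt N) => ℓn n z.1 z.2)
      (fun z => ℓ z.1 z.2) l (univ ×ˢ 𝒜))
    (hxn : Tendsto xn l (𝓝 x₀)) {σ : Fin D.q → SignType} (hx₀ : x₀ ∈ closure (D.stratum σ))
    (ha : a ∈ essCtrlOn 𝒜 f (D.stratum σ) x₀) {ε : ℝ} (hε : 0 < ε) :
    ∀ᶠ n in l, ∃ b ∈ 𝒜, ‖fn n (xn n) b - f x₀ a‖ < ε ∧ ℓn n (xn n) b < ℓ x₀ a + ε ∧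
      ∀ j, D.gap j x₀ = 0 →
        0 < (D.pushSign σ (xn n) j : ℝ) * inner ℝ (D.normal j) (fn n (xn n) b) := by
  obtain ⟨ha𝒜, -, htan⟩ := ha
  -- `pushSign σ (xn n)` varies with `n`, but takes finitely many values.
  have hall : ∀ s : {s // D.IsCell s ∧ ∀ j, σ j ≠ 0 → s j = σ j}, ∀ᶠ n in l, ∃ b ∈ 𝒜,
      ‖fn n (xn n) b - f x₀ a‖ < ε ∧ ℓn n (xn n) b < ℓ x₀ a + ε ∧
      ∀ j, D.gap j x₀ = 0 → 0 < (s.1 j : ℝ) * inner ℝ (D.normal j) (fn n (xn n) b) := by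
    rintro ⟨s, hs, hsσ⟩
    refine eventually_exists_control_strict_side h𝒜 hℓ hconv hG h2 hfn hℓn hxn ha𝒜 hs
      (fun j hj => ?_) hε
    by_cases hσj : σ j = 0
    · rw [D.inner_eq_zero_of_mem_tangentCone hx₀ htan hσj, mul_zero]
    · rw [hsσ j hσj]
      exact D.sign_mul_inner_nonneg_of_mem_tangentCone hx₀ htan hj
  filter_upwards [eventually_all.2 hall] with n hn
  exact hn ⟨D.pushSign σ (xn n), D.isCell_pushSign σ _, fun j hj => if_neg hj⟩

theorem eventually_exists_control_fderiv_flatPenalty_nonpos (h𝒜 : IsCompact 𝒜)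
    (hℓ : ∀ x, ∀ a ∈ 𝒜, ℓ x a ≤ cl * (1 + ‖x‖ ^ lam)) (hconv : HG 𝒜 f ℓ cl lam)
    (hG : Continuous (augDyn 𝒜 f ℓ cl lam)) (h2 : H2 D 𝒜 f)
    (hFn : ∀ n, LowerHemicontinuous (dyn 𝒜 (fn n)))
    (hfn : TendstoLocallyUniformlyOn (fun n (z : Pt d × Pt N) => fn n z.1 z.2)
      (fun z => f z.1 z.2) l (univ ×ˢ 𝒜))
    (hℓn : TendstoLocallyUniformlyOn (fun n (z : Pt d × Pt N) => ℓn n z.1 z.2)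
      (fun z => ℓ z.1 z.2) l (univ ×ˢ 𝒜))
    (hxn : Tendsto xn l (𝓝 x₀)) {σ : Fin D.q → SignType}
    (hmem : ∀ n, xn n ∈ closure (D.stratum (D.cellSign σ))) (hx₀ : x₀ ∈ closure (D.stratum σ))
    (ha : a ∈ essCtrlOn 𝒜 f (D.stratum σ) x₀) {ε : ℝ} (hε : 0 < ε) :
    ∀ᶠ n in l, ∃ b ∈ essCtrlOn 𝒜 (fn n) (D.stratum (D.cellSign σ)) (xn n),
      ‖fn n (xn n) b - f x₀ a‖ < ε ∧ ℓn n (xn n) b < ℓ x₀ a + ε ∧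
        fderiv ℝ (D.flatPenalty σ) (xn n) (fn n (xn n) b) ≤ 0 := by
  filter_upwards [eventually_exists_control_pushSign h𝒜 hℓ hconv hG h2 hfn hℓn hxn hx₀ ha hε,
    D.eventually_gap_eq_zero_imp hxn] with n ⟨b, hb, hfb, hℓb, hside⟩ hgap
  refine ⟨b, mem_essCtrlOn_cell (D.isCell_cellSign σ) (hFn n _) (hmem n) hb fun j hj => ?_,
    hfb, hℓb, D.fderiv_flatPenalty_nonpos (hmem n) fun j hj =>
      (hside j (D.closure_stratum_subset_flat σ hx₀ j hj)).le⟩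
  rw [← D.pushSign_eq_cellSign σ hj]
  exact (hside j (hgap j hj)).le

end Push

section PenalizedMaxima

theorem eq_zero_of_tendsto_of_le_sub_mul {ι : Type*} {l : Filter ι} [l.NeBot] {a b c q : ι → ℝ}
    {A B Q : ℝ} (ha : Tendsto a l (𝓝 A)) (hb : Tendsto b l (𝓝 B)) (hc : Tendsto c l atTop)
    (hq : Tendsto q l (𝓝 Q)) (hQ : 0 ≤ Q) (h : ∀ i, b i ≤ a i - c i * q i) : Q = 0 := by
  by_contra hne
  refine not_tendsto_nhds_of_tendsto_atTop ?_ _ (ha.sub hb)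
  exact tendsto_atTop_mono (fun i => by linarith [h i])
    (hc.atTop_mul_pos (hQ.lt_of_ne' hne) hq)

variable {E : Type*} [TopologicalSpace E] {w q : E → ℝ} {wn : ℕ → E → ℝ} {z₀ : E}

theorem tendsto_of_forall_le_sub_mul {B : Set E} (hB : IsCompact B) (hw : ContinuousOn w B)
    (hwn : TendstoLocallyUniformlyOn wn w atTop B) (hq : ContinuousOn q B)
    (hq0 : ∀ z ∈ B, 0 ≤ q z) (hz₀ : z₀ ∈ B)
    (huniq : ∀ z ∈ B, q z = 0 → w z₀ ≤ w z → z = z₀) {zn : ℕ → E} (hzn : ∀ n, zn n ∈ B)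
    (hmax : ∀ n, wn n z₀ ≤ wn n (zn n) - n * q (zn n)) : Tendsto zn atTop (𝓝 z₀) := by
  refine hB.tendsto_nhds_of_unique_mapClusterPt (Eventually.of_forall hzn) fun z hz hcl => ?_
  obtain ⟨U, hU, hlim⟩ := mapClusterPt_iff_ultrafilter.1 hcl
  have hlimB : Tendsto zn U (𝓝[B] z) :=
    tendsto_nhdsWithin_iff.2 ⟨hlim, Eventually.of_forall hzn⟩
  have hwnU : TendstoLocallyUniformlyOn wn w U B := fun s hs y hy =>
    let ⟨t, ht, h⟩ := hwn s hs y hy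
    ⟨t, ht, hU h⟩
  have hwnz : Tendsto (fun n => wn n (zn n)) U (𝓝 (w z)) := hwnU.tendsto_comp (hw z hz) hz hlimB
  have hwnz₀ : Tendsto (fun n => wn n z₀) U (𝓝 (w z₀)) := hwnU.tendsto_at hz₀
  have hqz : Tendsto (fun n => q (zn n)) U (𝓝 (q z)) := (hq z hz).tendsto.comp hlimB
  refine huniq z hz ?_ (le_of_tendsto_of_tendsto' hwnz₀ hwnz fun n => (hmax n).trans ?_)
  · exact eq_zero_of_tendsto_of_le_sub_mul hwnz hwnz₀ (tendsto_natCast_atTop_atTop.mono_left hU)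
      hqz (hq0 z hz) hmax
  · exact sub_le_self _ (mul_nonneg n.cast_nonneg (hq0 _ (hzn n)))

theorem exists_tendsto_isLocalMaxOn_sub_mul [LocallyCompactSpace E] {S : Set E}
    (hS : IsLocallyClosed S) (hw : ContinuousOn w S)
    (hwn_usc : ∀ n, UpperSemicontinuousOn (wn n) S) (hwn : TendstoLocallyUniformlyOn wn w atTop S)
    (hq : ContinuousOn q S) (hq0 : ∀ z ∈ S, 0 ≤ q z) (hz₀ : z₀ ∈ S) (hqz₀ : q z₀ = 0)
    (huniq : ∀ᶠ z in 𝓝[S] z₀, q z = 0 → w z₀ ≤ w z → z = z₀) :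
    ∃ zn : ℕ → E, (∀ n, zn n ∈ S) ∧ Tendsto zn atTop (𝓝 z₀) ∧
      ∀ᶠ n in atTop, IsLocalMaxOn (fun z => wn n z - n * q z) S (zn n) := by
  have := hS.locallyCompactSpace
  rw [nhdsWithin_eq_map_subtype_coe hz₀, eventually_map] at huniq
  obtain ⟨B', hB'z₀, hB'uniq, hB'⟩ := local_compact_nhds huniq
  set B : Set E := Subtype.val '' B'
  have hB : IsCompact B := hB'.image continuous_subtype_val
  have hBS : B ⊆ S := Subtype.coe_image_subset S B'
  have hBz₀ : B ∈ 𝓝[S] z₀ := nhdsWithin_eq_map_subtype_coe hz₀ ▸ image_mem_map hB'z₀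
  have hz₀B : z₀ ∈ B := mem_of_mem_nhdsWithin hz₀ hBz₀
  have hBuniq : ∀ z ∈ B, q z = 0 → w z₀ ≤ w z → z = z₀ := forall_mem_image.2 fun z hz => hB'uniq hz
  have hex : ∀ n : ℕ, ∃ z ∈ B, IsMaxOn (fun z => wn n z - n * q z) B z := fun n => by
    simp only [sub_eq_add_neg]
    exact UpperSemicontinuousOn.exists_isMaxOn ⟨z₀, hz₀B⟩ hB <| ((hwn_usc n).mono hBS).add
      (continuousOn_const.mul (hq.mono hBS)).neg.upperSemicontinuousOn
  choose zn hznB hzn using hex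
  have hlim : Tendsto zn atTop (𝓝 z₀) :=
    tendsto_of_forall_le_sub_mul hB (hw.mono hBS) (hwn.mono hBS) (hq.mono hBS)
      (fun z hz => hq0 z (hBS hz)) hz₀B hBuniq hznB fun n => by
        have hz₀n : wn n z₀ - n * q z₀ ≤ wn n (zn n) - n * q (zn n) := hzn n hz₀B
        rwa [hqz₀, mul_zero, sub_zero] at hz₀n
  refine ⟨zn, fun n => hBS (hznB n), hlim, ?_⟩
  have hlimS : Tendsto zn atTop (𝓝[S] z₀) :=
    tendsto_nhdsWithin_iff.2 ⟨hlim, Eventually.of_forall fun n => hBS (hznB n)⟩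
  filter_upwards [hlimS.eventually (eventually_eventually_nhdsWithin.2 hBz₀)] with n hn
  exact mem_of_superset hn fun z hz => hzn n hz

end PenalizedMaxima

section TestFunctions

/-- The function `|t - t₀|² + |x - x₀|²` of `z = (t, x)`, with `z₀ = (t₀, x₀)`: subtracted from a
test function it makes the maximum at `z₀` strict. -/
def sqDist {E : Type*} [SeminormedAddCommGroup E] (z₀ z : ℝ × E) : ℝ :=
  (z.1 - z₀.1) ^ 2 + ‖z.2 - z₀.2‖ ^ 2

theorem sqDist_self {E : Type*} [SeminormedAddCommGroup E] (z₀ : ℝ × E) : sqDist z₀ z₀ = 0 := by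
  simp [sqDist]

theorem sqDist_nonneg {E : Type*} [SeminormedAddCommGroup E] (z₀ z : ℝ × E) : 0 ≤ sqDist z₀ z :=
  add_nonneg (sq_nonneg _) (sq_nonneg _)

theorem sqDist_nonpos_iff {E : Type*} [NormedAddCommGroup E] {z₀ z : ℝ × E} :
    sqDist z₀ z ≤ 0 ↔ z = z₀ := by
  rw [(sqDist_nonneg z₀ z).ge_iff_eq', sqDist,
    add_eq_zero_iff_of_nonneg (sq_nonneg _) (sq_nonneg _), sq_eq_zero_iff, sq_eq_zero_iff,
    norm_eq_zero, sub_eq_zero, sub_eq_zero, Prod.ext_iff]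

variable {E : Type*} [NormedAddCommGroup E] [InnerProductSpace ℝ E]

theorem contDiff_sqDist (z₀ : ℝ × E) : ContDiff ℝ 1 (sqDist z₀) :=
  ((contDiff_fst.sub contDiff_const).pow 2).add ((contDiff_snd.sub contDiff_const).norm_sq ℝ)

theorem fderiv_sqDist_self (z₀ : ℝ × E) : fderiv ℝ (sqDist z₀) z₀ = 0 :=
  IsLocalMin.fderiv_eq_zero <| Eventually.of_forall fun z =>
    (sqDist_self z₀).le.trans (sqDist_nonneg z₀ z)

variable {d : ℕ} {T : ℝ} {M M' : Set (Pt d)} {φ : ℝ × Pt d → ℝ}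
  {δ : ℝ × Pt d → (ℝ × Pt d →L[ℝ] ℝ)}

theorem HasExtDiff.comp_prodMap_id (h : HasExtDiff T M φ δ) {P : Pt d → Pt d}
    {P' : Pt d →L[ℝ] Pt d} (hP : ∀ x, HasFDerivAt P P' x) (hPM : MapsTo P M' M) :
    HasExtDiff T M' (fun z => φ (Prod.map id P z)) fun z =>
      (δ (Prod.map id P z)).comp ((ContinuousLinearMap.id ℝ ℝ).prodMap P') := by
  have hPcont : Continuous P := continuous_iff_continuousAt.2 fun x => (hP x).continuousAt
  refine ⟨(h.1.comp (continuous_id.prodMap hPcont).continuousOn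
    ((mapsTo_id _).prodMap (hPM.closure hPcont))).clm_comp continuousOn_const, fun z hz => ?_⟩
  have hmaps : MapsTo (Prod.map id P) (Ioo 0 T ×ˢ M') (Ioo 0 T ×ˢ M) := (mapsTo_id _).prodMap hPM
  exact (h.2 _ (hmaps hz)).comp z ((hasFDerivAt_id z.1).prodMap z (hP z.2)).hasFDerivWithinAt hmaps

theorem HasExtDiff.add_contDiff (h : HasExtDiff T M φ δ) {g : ℝ × Pt d → ℝ}
    (hg : ContDiff ℝ 1 g) :
    HasExtDiff T M (fun z => φ z + g z) fun z => δ z + fderiv ℝ g z :=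
  ⟨h.1.add (hg.continuous_fderiv one_ne_zero).continuousOn, fun z hz =>
    (h.2 z hz).add (hg.differentiable one_ne_zero z).hasFDerivAt.hasFDerivWithinAt⟩

namespace MultiDomain

variable (D : MultiDomain d) {σ : Fin D.q → SignType} {z₀ : ℝ × Pt d}

/-- A test function on the closed stratum `σ` extended to the closed cell `cellSign σ`, constantly
in the directions normal to the flat of `σ`, and made strict at `z₀`. -/
noncomputable def liftTest (σ : Fin D.q → SignType) (φ : ℝ × Pt d → ℝ) (z₀ z : ℝ × Pt d) : ℝ :=
  φ (Prod.map id (D.proj σ) z) + sqDist z₀ z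

/-- The extended differential of `liftTest σ φ z₀`, where `δ` is that of `φ`. -/
noncomputable def liftTestDiff (σ : Fin D.q → SignType) (δ : ℝ × Pt d → (ℝ × Pt d →L[ℝ] ℝ))
    (z₀ z : ℝ × Pt d) : ℝ × Pt d →L[ℝ] ℝ :=
  (δ (Prod.map id (D.proj σ) z)).comp ((ContinuousLinearMap.id ℝ ℝ).prodMap (D.projLin σ)) +
    fderiv ℝ (sqDist z₀) z

theorem hasExtDiff_liftTest (hne : (D.stratum σ).Nonempty) (h : HasExtDiff T (D.stratum σ) φ δ)
    (z₀ : ℝ × Pt d) :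
    HasExtDiff T (D.stratum (D.cellSign σ)) (D.liftTest σ φ z₀) (D.liftTestDiff σ δ z₀) :=
  (h.comp_prodMap_id (D.hasFDerivAt_proj σ) (D.mapsTo_proj hne)).add_contDiff (contDiff_sqDist z₀)

theorem hasExtDiff_liftTest_add_flatPenalty (hne : (D.stratum σ).Nonempty)
    (h : HasExtDiff T (D.stratum σ) φ δ) (z₀ : ℝ × Pt d) (c : ℝ) :
    HasExtDiff T (D.stratum (D.cellSign σ))
      (fun z => D.liftTest σ φ z₀ z + c * D.flatPenalty σ z.2)
      fun z => D.liftTestDiff σ δ z₀ z + fderiv ℝ (fun z => c * D.flatPenalty σ z.2) z :=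
  (D.hasExtDiff_liftTest hne h z₀).add_contDiff
    (contDiff_const.mul ((D.contDiff_flatPenalty σ).comp contDiff_snd))

theorem fderiv_mul_flatPenalty_snd_apply (c : ℝ) (z v : ℝ × Pt d) :
    fderiv ℝ (fun z : ℝ × Pt d => c * D.flatPenalty σ z.2) z v =
      c * fderiv ℝ (D.flatPenalty σ) z.2 v.2 := by
  have h : HasFDerivAt (fun z : ℝ × Pt d => D.flatPenalty σ z.2) _ z :=
    ((D.contDiff_flatPenalty σ).differentiable one_ne_zero z.2).hasFDerivAt.comp z hasFDerivAt_snd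
  simp [(h.const_mul c).fderiv]

theorem continuousOn_liftTest (hφ : ContinuousOn φ (Ioo 0 T ×ˢ univ)) (z₀ : ℝ × Pt d) :
    ContinuousOn (D.liftTest σ φ z₀) (Ioo 0 T ×ˢ univ) :=
  (hφ.comp (continuous_id.prodMap (D.continuous_proj σ)).continuousOn
    ((mapsTo_id _).prodMap (mapsTo_univ _ _))).add (contDiff_sqDist z₀).continuous.continuousOn

theorem liftTest_of_mem_flat {z : ℝ × Pt d} (hz : z.2 ∈ D.flat σ) :
    D.liftTest σ φ z₀ z = φ z + sqDist z₀ z := by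
  rw [liftTest, Prod.map_apply', D.proj_eq_self hz, id, Prod.mk.eta]

theorem liftTestDiff_self_apply (hz₀ : z₀.2 ∈ D.flat σ) {v : Pt d}
    (hv : ∀ j, σ j = 0 → inner ℝ (D.normal j) v = 0) (s : ℝ) :
    D.liftTestDiff σ δ z₀ z₀ (s, v) = δ z₀ (s, v) := by
  simp [liftTestDiff, fderiv_sqDist_self, Prod.map_apply', D.proj_eq_self hz₀,
    D.projLin_eq_self hv]

theorem mem_closure_stratum_of_mem_flat (hne : (D.stratum σ).Nonempty) {x : Pt d}
    (hx : x ∈ closure (D.stratum (D.cellSign σ))) (hflat : x ∈ D.flat σ) :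
    x ∈ closure (D.stratum σ) := by
  rw [← D.proj_eq_self hflat]
  exact (D.mapsTo_proj hne).closure (D.continuous_proj σ) hx

end MultiDomain

end TestFunctions

theorem exists_pos_eventually_norm_apply_sub_lt {ι E F : Type*} [SeminormedAddCommGroup E]
    [NormedSpace ℝ E] [SeminormedAddCommGroup F] [NormedSpace ℝ F] {l : Filter ι}
    {δ : ι → E →L[ℝ] F} {δ₀ : E →L[ℝ] F} (hδ : Tendsto δ l (𝓝 δ₀)) {V : Set E}
    (hV : Bornology.IsBounded V) {κ : ℝ} (hκ : 0 < κ) :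
    ∃ η > 0, ∀ᶠ i in l, ∀ v ∈ V, ∀ v', ‖v' - v‖ < η → ‖δ i v' - δ₀ v‖ < κ := by
  obtain ⟨C, hC, hVC⟩ := hV.exists_pos_norm_le
  have hM : 0 < ‖δ₀‖ + 1 := by positivity
  refine ⟨κ / 2 / (‖δ₀‖ + 1), by positivity, ?_⟩
  filter_upwards [hδ.norm.eventually_lt_const (lt_add_one _),
    hδ.eventually_mem (Metric.ball_mem_nhds δ₀ (by positivity : 0 < κ / 2 / C))]
    with i hbound hclose v hv v' hv'
  rw [mem_ball_iff_norm, lt_div_iff₀ hC] at hclose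
  rw [lt_div_iff₀ hM] at hv'
  calc ‖δ i v' - δ₀ v‖ = ‖δ i (v' - v) + (δ i - δ₀) v‖ := by simp
    _ ≤ ‖δ i‖ * ‖v' - v‖ + ‖δ i - δ₀‖ * ‖v‖ :=
      norm_add_le_of_le ((δ i).le_opNorm _) ((δ i - δ₀).le_opNorm _)
    _ ≤ (‖δ₀‖ + 1) * ‖v' - v‖ + ‖δ i - δ₀‖ * C := by gcongr; exact hVC v hv
    _ < κ := by linarith

section Hamiltonian

variable {d N : ℕ} (f : Pt d → Pt N → Pt d) (ℓ : Pt d → Pt N → ℝ) (S : Set (Pt N)) (x : Pt d)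
  (δ : ℝ × Pt d →L[ℝ] ℝ)

theorem apply_one_mk (v : Pt d) : δ (1, v) = timePart δ + spacePart δ v := by
  simp [timePart, spacePart, ← map_add]

theorem neg_timePart_add_hamSup_nonpos_iff :
    ((-timePart δ : ℝ) : EReal) + hamSup f ℓ S x (spacePart δ) ≤ 0 ↔
      ∀ a ∈ S, 0 ≤ δ (1, f x a) + ℓ x a := by
  rw [EReal.coe_neg, add_comm, ← sub_eq_add_neg, EReal.sub_nonpos, hamSup, iSup₂_le_iff]
  refine forall₂_congr fun a _ => ?_
  rw [EReal.coe_le_coe_iff, apply_one_mk]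
  constructor <;> intro h <;> linarith

theorem nonneg_neg_timePart_add_hamSup_iff :
    0 ≤ ((-timePart δ : ℝ) : EReal) + hamSup f ℓ S x (spacePart δ) ↔
      ∀ ε > 0, ∃ a ∈ S, δ (1, f x a) + ℓ x a < ε := by
  rw [EReal.coe_neg, add_comm, ← sub_eq_add_neg,
    EReal.sub_nonneg (.inr (EReal.coe_ne_top _)) (.inr (EReal.coe_ne_bot _))]
  have hlt : ∀ ε : ℝ, ((timePart δ - ε : ℝ) : EReal) < hamSup f ℓ S x (spacePart δ) ↔
      ∃ a ∈ S, δ (1, f x a) + ℓ x a < ε := fun ε => by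
    simp only [hamSup, lt_iSup_iff, EReal.coe_lt_coe_iff, exists_prop, apply_one_mk]
    refine exists_congr fun a => and_congr_right fun _ => ?_
    constructor <;> intro h <;> linarith
  simp only [← hlt]
  refine ⟨fun h ε hε => (EReal.coe_lt_coe_iff.2 (sub_lt_self _ hε)).trans_le h,
    fun h => EReal.ge_of_forall_gt_iff_ge.1 fun r hr => ?_⟩
  simpa using (h (timePart δ - r) (sub_pos.2 (EReal.coe_lt_coe_iff.1 hr))).le

end Hamiltonian

section Stability

attribute [local instance] PseudoEMetricSpace.hausdorff

variable {d N : ℕ} {D : MultiDomain d} {𝒜 : Set (Pt N)} {f : Pt d → Pt N → Pt d}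
  {ℓ : Pt d → Pt N → ℝ} {T cl lam : ℝ} {fn : ℕ → Pt d → Pt N → Pt d}
  {ℓn : ℕ → Pt d → Pt N → ℝ} {un : ℕ → ℝ × Pt d → ℝ} {u : ℝ × Pt d → ℝ}

theorem exists_tendsto_isLocalMin_sub_sqDist
    (hun : ∀ n, LowerSemicontinuousOn (un n) (Ioc 0 T ×ˢ univ))
    (hulim : TendstoLocallyUniformlyOn un u atTop (Icc 0 T ×ˢ univ))
    (hu : ContinuousOn u (Icc 0 T ×ˢ univ)) {z₀ : ℝ × Pt d} (hz₀ : z₀.1 ∈ Ioo 0 T)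
    {φ : ℝ × Pt d → ℝ} (hφ : ContinuousOn φ (Ioo 0 T ×ˢ univ))
    (hmin : IsLocalMin (fun z => u z - φ z) z₀) :
    ∃ zn : ℕ → ℝ × Pt d, (∀ n, (zn n).1 ∈ Ioo 0 T) ∧ Tendsto zn atTop (𝓝 z₀) ∧
      ∀ᶠ n in atTop, IsLocalMin (fun z => un n z - (φ z - sqDist z₀ z)) (zn n) := by
  set S : Set (ℝ × Pt d) := Ioo 0 T ×ˢ univ
  have hS : IsOpen S := isOpen_Ioo.prod isOpen_univ
  have hSIcc : S ⊆ Icc 0 T ×ˢ univ := prod_mono_left Ioo_subset_Icc_self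
  have hSIoc : S ⊆ Ioc 0 T ×ˢ univ := prod_mono_left Ioo_subset_Ioc_self
  set ψ : ℝ × Pt d → ℝ := fun z => φ z - sqDist z₀ z
  have hψ : ContinuousOn ψ S := hφ.sub (contDiff_sqDist z₀).continuous.continuousOn
  have husc : ∀ n, UpperSemicontinuousOn (fun z => ψ z + -un n z) S := fun n =>
    hψ.upperSemicontinuousOn.add
      (continuous_neg.comp_lowerSemicontinuousOn_antitone ((hun n).mono hSIoc)
        fun _ _ => neg_le_neg)
  have hstrict : ∀ᶠ z in 𝓝[S] z₀, (0 : ℝ) = 0 → ψ z₀ - u z₀ ≤ ψ z - u z → z = z₀ := by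
    filter_upwards [hmin.filter_mono nhdsWithin_le_nhds] with z hz _ hle
    rw [← sqDist_nonpos_iff]
    simp only [ψ, sqDist_self] at hle
    linarith
  obtain ⟨zn, hznS, hzn, hmax⟩ := exists_tendsto_isLocalMaxOn_sub_mul (q := fun _ => 0)
    hS.isLocallyClosed (hψ.sub (hu.mono hSIcc)) (wn := fun n z => ψ z - un n z) husc
    (by simpa only [Metric.tendstoLocallyUniformlyOn_iff, dist_sub_left, Pi.sub_apply]
      using hulim.mono hSIcc)
    continuousOn_const (fun _ _ => le_rfl) ⟨hz₀, mem_univ _⟩ rfl hstrict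
  refine ⟨zn, fun n => (hznS n).1, hzn, ?_⟩
  filter_upwards [hmax] with n hn
  simpa only [mul_zero, sub_zero, neg_sub] using (hn.isLocalMax (hS.mem_nhds (hznS n))).neg

theorem IsSupersolution.of_tendsto (h𝒜 : IsCompact 𝒜)
    (hF : ∀ x, Bornology.IsBounded (dyn 𝒜 f x))
    (hℓ : ∀ x, ∀ a ∈ 𝒜, ℓ x a ≤ cl * (1 + ‖x‖ ^ lam)) (hG : Continuous (augDyn 𝒜 f ℓ cl lam))
    (hfn : TendstoLocallyUniformlyOn (fun n (z : Pt d × Pt N) => fn n z.1 z.2)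
      (fun z => f z.1 z.2) atTop (univ ×ˢ 𝒜))
    (hℓn : TendstoLocallyUniformlyOn (fun n (z : Pt d × Pt N) => ℓn n z.1 z.2)
      (fun z => ℓ z.1 z.2) atTop (univ ×ˢ 𝒜))
    (hun : ∀ n, IsSupersolution D 𝒜 (fn n) (ℓn n) T (un n))
    (hulim : TendstoLocallyUniformlyOn un u atTop (Icc 0 T ×ˢ univ))
    (hu : ContinuousOn u (Icc 0 T ×ˢ univ)) : IsSupersolution D 𝒜 f ℓ T u := by
  refine ⟨(hu.mono (prod_mono_left Ioc_subset_Icc_self)).lowerSemicontinuousOn,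
    fun t x ht φ hφ hmin => ?_⟩
  obtain ⟨zn, hznT, hzn, hloc⟩ := exists_tendsto_isLocalMin_sub_sqDist (fun n => (hun n).1) hulim
    hu ht hφ.continuousOn hmin
  set ψ : ℝ × Pt d → ℝ := fun z => φ z - sqDist (t, x) z
  have hψ : ContDiffOn ℝ 1 ψ (Ioo 0 T ×ˢ univ) := hφ.sub (contDiff_sqDist _).contDiffOn
  have hS : IsOpen (Ioo 0 T ×ˢ (univ : Set (Pt d))) := isOpen_Ioo.prod isOpen_univ
  have hz₀ : Ioo 0 T ×ˢ (univ : Set (Pt d)) ∈ 𝓝 (t, x) := hS.mem_nhds ⟨ht, mem_univ _⟩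
  have hψφ : fderiv ℝ ψ (t, x) = fderiv ℝ φ (t, x) := by
    rw [fderiv_fun_sub ((hφ.contDiffAt hz₀).differentiableAt one_ne_zero)
      ((contDiff_sqDist _).differentiable one_ne_zero _), fderiv_sqDist_self, sub_zero]
  have hderiv : Tendsto (fun n => fderiv ℝ ψ (zn n)) atTop (𝓝 (fderiv ℝ φ (t, x))) :=
    hψφ ▸ ((hψ.continuousOn_fderiv_of_isOpen hS le_rfl).continuousAt hz₀).tendsto.comp hzn
  rw [hamE, essCtrl_eq_of_lowerHemicontinuousAt
    (lowerHemicontinuous_dyn hℓ (lowerHemicontinuous_of_continuous_hausdorff hG) x),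
    nonneg_neg_timePart_add_hamSup_iff]
  intro ε hε
  obtain ⟨η, hη, hclose⟩ := exists_pos_eventually_norm_apply_sub_lt hderiv
    ((Bornology.isBounded_singleton (x := (1 : ℝ))).prod (hF x)) (by positivity : 0 < ε / 3)
  obtain ⟨n, hn, hclose, -, hctrl⟩ := (hloc.and (hclose.and (eventually_exists_control_of_tendsto
    h𝒜 hℓ hG hfn hℓn ((continuous_snd.tendsto _).comp hzn)
    (lt_min hη (by positivity : 0 < ε / 3))))).exists
  obtain ⟨b, hb, hbval⟩ := (nonneg_neg_timePart_add_hamSup_iff ..).1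
    ((hun n).2 (zn n).1 (zn n).2 (hznT n) ψ hψ hn) (ε / 3) (by positivity)
  obtain ⟨a, ha, hfa, hℓa⟩ := hctrl b (essCtrl_subset _ hb)
  have hδ := hclose (1, f x a) ⟨rfl, mem_image_of_mem _ ha⟩ (1, fn n (zn n).2 b) (by
    simpa [norm_sub_rev] using hfa.trans_le (min_le_left _ _))
  refine ⟨a, ha, ?_⟩
  simp only [Prod.mk.eta, Function.comp_apply] at hbval hℓa
  linarith [(abs_lt.1 hδ).1, min_le_right η (ε / 3)]

theorem eventually_eq_of_sub_liftTest_le {σ : Fin D.q → SignType} {z₀ : ℝ × Pt d}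
    (hz₀ : z₀.2 ∈ closure (D.stratum σ)) {φ : ℝ × Pt d → ℝ}
    (hmax : IsLocalMaxOn (fun z => u z - φ z) (Ioo 0 T ×ˢ closure (D.stratum σ)) z₀) :
    ∀ᶠ z in 𝓝[Ioo 0 T ×ˢ closure (D.stratum (D.cellSign σ))] z₀, D.flatPenalty σ z.2 = 0 →
      u z₀ - D.liftTest σ φ z₀ z₀ ≤ u z - D.liftTest σ φ z₀ z → z = z₀ := by
  filter_upwards [eventually_nhdsWithin_of_eventually_nhds (eventually_nhdsWithin_iff.1 hmax),
    self_mem_nhdsWithin] with z hz hzS hqz hle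
  have hflat : z.2 ∈ D.flat σ := D.flatPenalty_eq_zero_iff.1 hqz
  have hle' := hz ⟨hzS.1, D.mem_closure_stratum_of_mem_flat
    (closure_nonempty_iff.1 ⟨z₀.2, hz₀⟩) hzS.2 hflat⟩
  rw [D.liftTest_of_mem_flat hflat,
    D.liftTest_of_mem_flat (D.closure_stratum_subset_flat σ hz₀), sqDist_self] at hle
  rw [← sqDist_nonpos_iff]
  linarith

theorem exists_tendsto_isLocalMaxOn_sub_liftTest
    (hun : ∀ n, UpperSemicontinuousOn (un n) (Ioc 0 T ×ˢ univ))
    (hulim : TendstoLocallyUniformlyOn un u atTop (Icc 0 T ×ˢ univ))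
    (hu : ContinuousOn u (Icc 0 T ×ˢ univ)) {σ : Fin D.q → SignType} {z₀ : ℝ × Pt d}
    (hz₀ : z₀ ∈ Ioo 0 T ×ˢ closure (D.stratum σ)) {φ : ℝ × Pt d → ℝ}
    (hφ : ContinuousOn φ (Ioo 0 T ×ˢ univ))
    (hmax : IsLocalMaxOn (fun z => u z - φ z) (Ioo 0 T ×ˢ closure (D.stratum σ)) z₀) :
    ∃ zn : ℕ → ℝ × Pt d, (∀ n, zn n ∈ Ioo 0 T ×ˢ closure (D.stratum (D.cellSign σ))) ∧
      Tendsto zn atTop (𝓝 z₀) ∧ ∀ᶠ n in atTop,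
        IsLocalMaxOn (fun z => un n z - (D.liftTest σ φ z₀ z + n * D.flatPenalty σ z.2))
          (Ioo 0 T ×ˢ closure (D.stratum (D.cellSign σ))) (zn n) := by
  set S : Set (ℝ × Pt d) := Ioo 0 T ×ˢ closure (D.stratum (D.cellSign σ))
  have hS : IsLocallyClosed S := ⟨Ioo 0 T ×ˢ univ, univ ×ˢ closure (D.stratum (D.cellSign σ)),
    isOpen_Ioo.prod isOpen_univ, isClosed_univ.prod isClosed_closure, by simp [S, prod_inter_prod]⟩
  have hSIcc : S ⊆ Icc 0 T ×ˢ univ := prod_mono Ioo_subset_Icc_self (subset_univ _)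
  have hSIoc : S ⊆ Ioc 0 T ×ˢ univ := prod_mono Ioo_subset_Ioc_self (subset_univ _)
  have hg : ContinuousOn (D.liftTest σ φ z₀) S :=
    (D.continuousOn_liftTest hφ z₀).mono (prod_mono_right (subset_univ _))
  have husc : ∀ n, UpperSemicontinuousOn (fun z => un n z + -D.liftTest σ φ z₀ z) S := fun n =>
    ((hun n).mono hSIoc).add hg.neg.upperSemicontinuousOn
  obtain ⟨zn, hznS, hzn, hloc⟩ := exists_tendsto_isLocalMaxOn_sub_mul
    (q := fun z => D.flatPenalty σ z.2) hS
    (hu.mono hSIcc |>.sub hg) (wn := fun n z => un n z - D.liftTest σ φ z₀ z) husc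
    (by simpa only [Metric.tendstoLocallyUniformlyOn_iff, dist_sub_right, Pi.sub_apply]
      using hulim.mono hSIcc)
    ((D.contDiff_flatPenalty σ).continuous.comp continuous_snd).continuousOn
    (fun z _ => D.flatPenalty_nonneg σ z.2)
    ⟨hz₀.1, D.closure_stratum_subset_closure_cellSign σ hz₀.2⟩
    (D.flatPenalty_eq_zero_iff.2 (D.closure_stratum_subset_flat σ hz₀.2))
    (eventually_eq_of_sub_liftTest_le hz₀.2 hmax)
  exact ⟨zn, hznS, hzn, by simpa only [sub_sub] using hloc⟩

theorem IsSubsolution.of_tendsto (h𝒜 : IsCompact 𝒜)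
    (hℓ : ∀ x, ∀ a ∈ 𝒜, ℓ x a ≤ cl * (1 + ‖x‖ ^ lam)) (hconv : HG 𝒜 f ℓ cl lam)
    (hG : Continuous (augDyn 𝒜 f ℓ cl lam)) (h2 : H2 D 𝒜 f)
    (hFn : ∀ n, LowerHemicontinuous (dyn 𝒜 (fn n)))
    (hfn : TendstoLocallyUniformlyOn (fun n (z : Pt d × Pt N) => fn n z.1 z.2)
      (fun z => f z.1 z.2) atTop (univ ×ˢ 𝒜))
    (hℓn : TendstoLocallyUniformlyOn (fun n (z : Pt d × Pt N) => ℓn n z.1 z.2)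
      (fun z => ℓ z.1 z.2) atTop (univ ×ˢ 𝒜))
    (hun : ∀ n, IsSubsolution D 𝒜 (fn n) (ℓn n) T (un n))
    (hulim : TendstoLocallyUniformlyOn un u atTop (Icc 0 T ×ˢ univ))
    (hu : ContinuousOn u (Icc 0 T ×ˢ univ)) : IsSubsolution D 𝒜 f ℓ T u := by
  refine ⟨(hu.mono (prod_mono_left Ioc_subset_Icc_self)).upperSemicontinuousOn,
    fun t x ht σ hx φ δ hφ hδ hmax => ?_⟩
  have hne : (D.stratum σ).Nonempty := closure_nonempty_iff.1 ⟨x, hx⟩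
  obtain ⟨zn, hznS, hzn, hloc⟩ := exists_tendsto_isLocalMaxOn_sub_liftTest (fun n => (hun n).1)
    hulim hu ⟨ht, hx⟩ hφ hmax
  have hderiv : Tendsto (fun n => D.liftTestDiff σ δ (t, x) (zn n)) atTop
      (𝓝 (D.liftTestDiff σ δ (t, x) (t, x))) :=
    ((D.hasExtDiff_liftTest hne hδ (t, x)).1 (t, x)
      ⟨ht, D.closure_stratum_subset_closure_cellSign σ hx⟩).tendsto.comp
      (tendsto_nhdsWithin_iff.2 ⟨hzn, Eventually.of_forall hznS⟩)
  rw [neg_timePart_add_hamSup_nonpos_iff]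
  refine fun a ha => le_of_forall_pos_le_add fun ε hε => ?_
  obtain ⟨η, hη, hclose⟩ := exists_pos_eventually_norm_apply_sub_lt hderiv
    (Bornology.isBounded_singleton (x := ((1 : ℝ), f x a))) (half_pos hε)
  obtain ⟨n, hn, hclose, b, hb, hfb, hℓb, hpen⟩ := (hloc.and (hclose.and
    (eventually_exists_control_fderiv_flatPenalty_nonpos h𝒜 hℓ hconv hG h2 hFn hfn hℓn
      ((continuous_snd.tendsto _).comp hzn) (fun n => (hznS n).2) hx ha
      (lt_min hη (half_pos hε))))).exists
  have hsub := (neg_timePart_add_hamSup_nonpos_iff ..).1 ((hun n).2 (zn n).1 (zn n).2 (hznS n).1 _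
    (hznS n).2 _ _ ((D.continuousOn_liftTest hφ (t, x)).add
      (((D.contDiff_flatPenalty σ).continuous.comp continuous_snd).const_mul
        (n : ℝ)).continuousOn) (D.hasExtDiff_liftTest_add_flatPenalty hne hδ (t, x) n) hn) b hb
  have hδ := hclose _ rfl (1, fn n (zn n).2 b) (by simpa using hfb.trans_le (min_le_left _ _))
  rw [D.liftTestDiff_self_apply (D.closure_stratum_subset_flat σ hx)
    fun j hj => D.inner_eq_zero_of_mem_tangentCone hx ha.2.2 hj] at hδ
  simp only [Prod.mk.eta, add_apply, D.fderiv_mul_flatPenalty_snd_apply] at hsub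
  have hpen_n := mul_nonpos_of_nonneg_of_nonpos (n.cast_nonneg (α := ℝ)) hpen
  simp only [Function.comp_apply] at hℓb hpen_n
  linarith [(abs_lt.1 hδ).2, min_le_right η (ε / 2)]

end Stability

end HJB

attribute [local instance] PseudoEMetricSpace.hausdorff in
theorem mainTheorem11_general {d N : ℕ} (D : MultiDomain d) (𝒜 : Set (Pt N)) (h𝒜 : IsCompact 𝒜)
    (T : ℝ) (hT : 0 < T) (f : Pt d → Pt N → Pt d) (ℓ : Pt d → Pt N → ℝ) (cl lam : ℝ)
    (hF : ∀ x, Bornology.IsBounded (dyn 𝒜 f x))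
    (hℓ : ∀ x, ∀ a ∈ 𝒜, ℓ x a ≤ cl * (1 + ‖x‖ ^ lam))
    (hconv : HG 𝒜 f ℓ cl lam) (hG : Continuous (augDyn 𝒜 f ℓ cl lam)) (h2 : H2 D 𝒜 f)
    (fn : ℕ → Pt d → Pt N → Pt d) (ℓn : ℕ → Pt d → Pt N → ℝ)
    (hFn : ∀ n, LowerHemicontinuous (dyn 𝒜 (fn n)))
    (hfn : TendstoLocallyUniformlyOn (fun n (z : Pt d × Pt N) => fn n z.1 z.2)
      (fun z => f z.1 z.2) atTop (univ ×ˢ 𝒜))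
    (hℓn : TendstoLocallyUniformlyOn (fun n (z : Pt d × Pt N) => ℓn n z.1 z.2)
      (fun z => ℓ z.1 z.2) atTop (univ ×ˢ 𝒜))
    (φ : Pt d → ℝ) (φn : ℕ → Pt d → ℝ) (hφlim : ∀ x, Tendsto (fun n => φn n x) atTop (𝓝 (φ x)))
    (un : ℕ → ℝ × Pt d → ℝ) (u : ℝ × Pt d → ℝ)
    (hun : ∀ n, IsSolution D 𝒜 (fn n) (ℓn n) T (φn n) (un n))
    (hulim : TendstoLocallyUniformlyOn un u atTop (Icc 0 T ×ˢ univ))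
    (hu : ContinuousOn u (Icc 0 T ×ˢ univ)) : IsSolution D 𝒜 f ℓ T φ u := by
  refine ⟨.of_tendsto h𝒜 hF hℓ hG hfn hℓn (fun n => (hun n).1) hulim hu,
    .of_tendsto h𝒜 hℓ hconv hG h2 hFn hfn hℓn (fun n => (hun n).2.1) hulim hu, fun x => ?_⟩
  have hlim : Tendsto (fun n => un n (T, x)) atTop (𝓝 (u (T, x))) :=
    hulim.tendsto_at ⟨right_mem_Icc.2 hT.le, mem_univ x⟩
  exact tendsto_nhds_unique hlim (by simpa only [(hun _).2.2 x] using hφlim x)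

theorem mainTheorem11 {d N : ℕ} (D : MultiDomain d) (𝒜 : Set (Pt N)) (h𝒜 : IsCompact 𝒜)
    (T : ℝ) (hT : 0 < T)
    (f : Pt d → Pt N → Pt d) (ℓ : Pt d → Pt N → ℝ)
    (cf cl lam : ℝ) (KF KL : ℝ → ℝ≥0)
    (hF : HF D 𝒜 f cf KF) (hL : HL D 𝒜 ℓ cl lam KL)
    (hG : HG 𝒜 f ℓ cl lam) (hGLip : AugLipschitz D 𝒜 f ℓ cl lam) (h2 : H2 D 𝒜 f)
    (fn : ℕ → Pt d → Pt N → Pt d) (ℓn : ℕ → Pt d → Pt N → ℝ)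
    (cf' cl' lam' : ℝ) (KF' KL' : ℝ → ℝ≥0)
    (hFn : ∀ n, HF D 𝒜 (fn n) cf' KF') (hLn : ∀ n, HL D 𝒜 (ℓn n) cl' lam' KL')
    (hfn : TendstoLocallyUniformlyOn (fun n (z : Pt d × Pt N) => fn n z.1 z.2)
      (fun z => f z.1 z.2) atTop (univ ×ˢ 𝒜))
    (hℓn : TendstoLocallyUniformlyOn (fun n (z : Pt d × Pt N) => ℓn n z.1 z.2)
      (fun z => ℓ z.1 z.2) atTop (univ ×ˢ 𝒜))
    (φ : Pt d → ℝ) (hφ : ∃ K, LipschitzWith K φ)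
    (φn : ℕ → Pt d → ℝ) (hφn : ∀ n, ∃ K, LipschitzWith K (φn n))
    (hφlim : TendstoLocallyUniformly φn φ atTop)
    (un : ℕ → ℝ × Pt d → ℝ) (u : ℝ × Pt d → ℝ)
    (hun : ∀ n, IsSolution D 𝒜 (fn n) (ℓn n) T (φn n) (un n))
    (hunLip : ∀ n, LocallyLipschitzOn (Icc 0 T ×ˢ D.interface) (un n))
    (hulim : TendstoLocallyUniformlyOn un u atTop (Icc 0 T ×ˢ univ))
    (hu : ContinuousOn u (Icc 0 T ×ˢ univ)) :
    IsSolution D 𝒜 f ℓ T φ u := by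
  exact mainTheorem11_general D 𝒜 h𝒜 T hT f ℓ cl lam (fun x => (hF.compact x).isBounded)
    (fun x _ ha => (hL.growth x _ (mem_image_of_mem _ ha)).2) hG hGLip.continuous h2 fn ℓn
    (fun n => (hFn n).lowerHemicontinuous) hfn hℓn φ φn
    (fun x => (tendstoLocallyUniformlyOn_univ.2 hφlim).tendsto_at (mem_univ x)) un u hun hulim hu
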